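/- Let $k$ be a field of characteristic $0$. A curved Lie algebra over $k$ is a $\mathbb{Z}$-graded Lie algebra $\mathfrak{g}$ (cohomological grading, usual sign rule) with an element $\Omega\in\mathfrak{g}^2$ and a degree one derivation $d$ such that $d^2\eta=[\Omega,\eta]$ for all $\eta$ and $d\Omega=0$. A morphism is a degree-preserving linear map that commutes with the brackets and with $d$ and maps $\Omega$ to $\Omega$. A Maurer--Cartan element is a $\xi\in\mathfrak{g}^1$ with $\Omega+d\xi+\tfrac12[\xi,\xi]=0$; the set of these is $\mathrm{MC}(\mathfrak{g})$. Let $\mathfrak{k}$ be a curved Lie algebra with a descending filtration $\mathfrak{k}=F_1\supset F_2\supset\cdots$ by graded subspaces with $[F_p,F_q]\subset F_{p+q}$ and $dF_n\subset F_n$, which is complete, i.e. $\mathfrak{k}^i=\varprojlim_n \mathfrak{k}^i/F_n^i$ in every degree $i$ (in particular $\bigcap_n F_n=0$). Let $k[z,dz]$ be the free unital differential graded commutative algebra on $z$ (degree $0$) and $dz$ (degree $1$), and let $\mathfrak{k}[z,dz]=\varprojlim_n(\mathfrak{k}/F_n)\otimes k[z,dz]$ (limit taken degreewise), a curved Lie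 algebra with curvature $\Omega\otimes 1$. Two elements $\xi,\eta\in\mathrm{MC}(\mathfrak{k})$ are homotopic if there is $h\in\mathrm{MC}(\mathfrak{k}[z,dz])$ with $h|_{z=0}=\xi$ and $h|_{z=1}=\eta$ (where $dz\mapsto 0$). The Maurer--Cartan moduli set $\mathscr{MC}(\mathfrak{k})$ is the quotient of $\mathrm{MC}(\mathfrak{k})$ by the equivalence relation generated by homotopy. Put $C_n^\bullet(\mathfrak{k})=F_n/F_{n+1}$ with the differential induced by $d$ (it squares to zero since $\Omega\in F_1$). Let $\mathfrak{k}'$, with filtration $F'_n$, be another curved Lie algebra of this kind. A filtered quasi-isomorphism $\theta\colon\mathfrak{k}\to\mathfrak{k}'$ is a morphism of curved Lie algebras with $\theta(F_n)\subset F'_n$ for all $n$ such that all the induced maps $C_n^\bullet(\mathfrak{k})\to C_n^\bullet(\mathfrak{k}')$ are quasi-isomorphisms. **Theorem.** Let $\theta\colon\mathfrak{k}\to\mathfrak{k}'$ be a filtered quasi-isomorphism. Then the map $\mathscr{MC}(\mathfrak{k})\to\mathscr{MC}(\mathfrak{k}')$, $[\xi]\mapsto[\theta(\xi)]$, is well defined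 and bijective. -/

import Mathlib

universe u v

namespace CurvedLie

open CategoryTheory

/-! ## Curved Lie algebras -/

/-- A (cohomologically `ℤ`-graded) curved Lie algebra over `k`.  The homogeneous component of degree
`i` is `L i`; the bracket and the predifferential are indexed by proofs of the equalities of degrees,
so that no casts are needed. -/
structure CurvedLieAlgebra (k : Type u) [Field k] where
  L : ℤ → Type v
  [instAddCommGroup : ∀ i, AddCommGroup (L i)]
  [instModule : ∀ i, Module k (L i)]
  /-- the Lie bracket -/
  br : ∀ {i j l : ℤ}, i + j = l → (L i →ₗ[k] L j →ₗ[k] L l)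
  /-- the predifferential -/
  d : ∀ {i j : ℤ}, i + 1 = j → (L i →ₗ[k] L j)
  /-- the curvature -/
  Ω : L 2
  /-- `[x, y] = -(-1)^{|x||y|} [y, x]` -/
  br_antisymm : ∀ {i j l : ℤ} (h : i + j = l) (h' : j + i = l) (x : L i) (y : L j),
    br h x y = -((-1 : k) ^ (i * j) • br h' y x)
  /-- `[x, [y, z]] = [[x, y], z] + (-1)^{|x||y|} [y, [x, z]]` -/
  jacobi : ∀ {i j m jm ij im t : ℤ} (h₁ : j + m = jm) (h₂ : i + jm = t) (h₃ : i + j = ij)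
    (h₄ : ij + m = t) (h₅ : i + m = im) (h₆ : j + im = t) (x : L i) (y : L j) (z : L m),
    br h₂ x (br h₁ y z) = br h₄ (br h₃ x y) z + (-1 : k) ^ (i * j) • br h₆ y (br h₅ x z)
  /-- `d [x, y] = [d x, y] + (-1)^{|x|} [x, d y]` -/
  leibniz : ∀ {i j l i' j' l' : ℤ} (h : i + j = l) (hl : l + 1 = l') (hi : i + 1 = i')
    (hj : j + 1 = j') (h₁ : i' + j = l') (h₂ : i + j' = l') (x : L i) (y : L j),
    d hl (br h x y) = br h₁ (d hi x) y + (-1 : k) ^ i • br h₂ x (d hj y)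
  /-- `d² x = [Ω, x]` -/
  d_d : ∀ {i j l : ℤ} (h : i + 1 = j) (h' : j + 1 = l) (h₂ : 2 + i = l) (x : L i),
    d h' (d h x) = br h₂ Ω x
  d_Ω : d (show (2 : ℤ) + 1 = 3 by norm_num) Ω = 0

attribute [instance] CurvedLieAlgebra.instAddCommGroup CurvedLieAlgebra.instModule

variable {k : Type u} [Field k]

/-- `ξ` is a Maurer–Cartan element: it has degree one and `Ω + dξ + ½ [ξ, ξ] = 0`. -/
def CurvedLieAlgebra.IsMC (g : CurvedLieAlgebra.{u, v} k) (ξ : g.L 1) : Prop :=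
  g.Ω + g.d (show (1 : ℤ) + 1 = 2 by norm_num) ξ
    + (2 : k)⁻¹ • g.br (show (1 : ℤ) + 1 = 2 by norm_num) ξ ξ = 0

/-- The set `MC(g)` of Maurer–Cartan elements. -/
def CurvedLieAlgebra.MC (g : CurvedLieAlgebra.{u, v} k) : Type v := {ξ : g.L 1 // g.IsMC ξ}

/-- Morphisms of curved Lie algebras. -/
structure CurvedLieHom (g h : CurvedLieAlgebra.{u, v} k) where
  f : ∀ i : ℤ, g.L i →ₗ[k] h.L i
  map_br : ∀ {i j l : ℤ} (e : i + j = l) (x : g.L i) (y : g.L j),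
    f l (g.br e x y) = h.br e (f i x) (f j y)
  map_d : ∀ {i j : ℤ} (e : i + 1 = j) (x : g.L i), f j (g.d e x) = h.d e (f i x)
  map_Ω : f 2 g.Ω = h.Ω

/-- A curved Lie algebra with a complete (in particular Hausdorff) descending filtration
`F 0 ⊇ F 1 ⊇ F 2 ⊇ …` by graded subspaces which is respected by the bracket and the predifferential
and such that `F 1` is everything. -/
structure FilteredCurvedLieAlgebra (k : Type u) [Field k] extends CurvedLieAlgebra.{u, v} k where
  F : ℕ → ∀ i : ℤ, Submodule k (L i)
  F_anti : ∀ (n : ℕ) (i : ℤ), F (n + 1) i ≤ F n i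
  F_one : ∀ i : ℤ, F 1 i = ⊤
  br_mem : ∀ {p q : ℕ} {i j l : ℤ} (h : i + j = l) {x : L i} {y : L j},
    x ∈ F p i → y ∈ F q j → br h x y ∈ F (p + q) l
  d_mem : ∀ {n : ℕ} {i j : ℤ} (h : i + 1 = j) {x : L i}, x ∈ F n i → d h x ∈ F n j
  /-- the map to the (degreewise) limit of the quotients by the `F n` is injective -/
  hausdorff : ∀ {i : ℤ} (x : L i), (∀ n, x ∈ F n i) → x = 0
  /-- the map to the (degreewise) limit of the quotients by the `F n` is surjective -/
  complete : ∀ {i : ℤ} (x : ℕ → L i), (∀ n, x (n + 1) - x n ∈ F n i) →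
    ∃ y : L i, ∀ n, y - x n ∈ F n i

/-- Morphisms of curved Lie algebras that preserve the filtration degree. -/
structure FilteredCurvedLieHom (g h : FilteredCurvedLieAlgebra.{u, v} k) extends
    CurvedLieHom g.toCurvedLieAlgebra h.toCurvedLieAlgebra where
  map_F : ∀ {n : ℕ} {i : ℤ} {x : g.L i}, x ∈ g.F n i → f i x ∈ h.F n i

/-! ## The associated graded complexes and filtered quasi-isomorphisms -/

section AssociatedGraded

variable (g h : FilteredCurvedLieAlgebra.{u, v} k)

/-- The degree `i` part of `F n / F (n + 1)`. -/
abbrev gr (n : ℕ) (i : ℤ) : Type v := g.F n i ⧸ (g.F (n + 1) i).comap (g.F n i).subtype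

/-- The map `F n / F (n + 1) → F n / F (n + 1)` of degree one induced by the predifferential. -/
def grD (n : ℕ) {i j : ℤ} (e : i + 1 = j) : gr g n i →ₗ[k] gr g n j :=
  Submodule.mapQ _ _ ((g.d e).restrict (fun _ hx => g.d_mem e hx)) (by
    intro x hx
    exact g.d_mem e hx)

theorem grD_grD (n : ℕ) {i j l : ℤ} (e : i + 1 = j) (e' : j + 1 = l) (x : gr g n i) :
    grD g n e' (grD g n e x) = 0 := by
  obtain ⟨x, rfl⟩ := Submodule.Quotient.mk_surjective _ x
  refine (Submodule.Quotient.mk_eq_zero _).2 ?_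
  change g.d e' (g.d e (x : g.L i)) ∈ g.F (n + 1) l
  rw [g.d_d e e' (by omega), Nat.add_comm n 1]
  exact g.br_mem _ (by rw [g.F_one]; trivial) x.2

/-- The cochain complex `C_n^•(g) = F n / F (n + 1)`. -/
def grComplex (n : ℕ) : CochainComplex (ModuleCat.{v} k) ℤ where
  X i := ModuleCat.of k (gr g n i)
  d i j := if e : i + 1 = j then ModuleCat.ofHom (grD g n e) else 0
  shape i j e := dif_neg e
  d_comp_d' i j l e e' := by
    rw [dif_pos (show i + 1 = j from e), dif_pos (show j + 1 = l from e')]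
    exact ModuleCat.hom_ext (LinearMap.ext fun x => grD_grD g n e e' x)

variable {g h}

/-- The map `F n / F (n + 1) → F' n / F' (n + 1)` induced by `θ`. -/
def grHom (θ : FilteredCurvedLieHom g h) (n : ℕ) (i : ℤ) : gr g n i →ₗ[k] gr h n i :=
  Submodule.mapQ _ _ ((θ.f i).restrict (fun _ hx => θ.map_F hx)) (by
    intro x hx
    exact θ.map_F hx)

/-- The cochain map `C_n^•(g) → C_n^•(h)` induced by `θ`. -/
def grComplexMap (θ : FilteredCurvedLieHom g h) (n : ℕ) : grComplex g n ⟶ grComplex h n where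
  f i := ModuleCat.ofHom (grHom θ n i)
  comm' i j e := by
    have e' : i + 1 = j := e
    simp only [grComplex, dif_pos e']
    refine ModuleCat.hom_ext (LinearMap.ext fun x => ?_)
    obtain ⟨x, rfl⟩ := Submodule.Quotient.mk_surjective _ x
    change Submodule.Quotient.mk _ = Submodule.Quotient.mk _
    congr 1
    exact Subtype.ext (θ.map_d e' x).symm

/-- `θ` is a filtered quasi-isomorphism. -/
def IsFilteredQuasiIso (θ : FilteredCurvedLieHom g h) : Prop :=
  ∀ n : ℕ, QuasiIso (grComplexMap θ n)

end AssociatedGraded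

/-! ## Polynomial forms on the interval with coefficients in a filtered curved Lie algebra -/

section Convolution

variable {M N P Q R S T : Type*} [AddCommGroup M] [AddCommGroup N] [AddCommGroup P] [AddCommGroup Q]
  [AddCommGroup R] [AddCommGroup S] [AddCommGroup T] [Module k M] [Module k N] [Module k P]
  [Module k Q] [Module k R] [Module k S] [Module k T]

/-- The coefficients of the product of `∑ a_p z^p` and `∑ b_q z^q` with respect to `B`. -/
def conv (B : M →ₗ[k] N →ₗ[k] P) (a : ℕ → M) (b : ℕ → N) (n : ℕ) : P :=
  ∑ pq ∈ Finset.HasAntidiagonal.antidiagonal n, B (a pq.1) (b pq.2)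

theorem conv_add_left (B : M →ₗ[k] N →ₗ[k] P) (a a' : ℕ → M) (b : ℕ → N) :
    conv B (a + a') b = conv B a b + conv B a' b := by
  funext n; simp [conv, Finset.sum_add_distrib]

theorem conv_zero_left (B : M →ₗ[k] N →ₗ[k] P) (b : ℕ → N) : conv B 0 b = 0 := by
  funext n; simp [conv]

theorem conv_add_right (B : M →ₗ[k] N →ₗ[k] P) (a : ℕ → M) (b b' : ℕ → N) :
    conv B a (b + b') = conv B a b + conv B a b' := by
  funext n; simp [conv, Finset.sum_add_distrib]

theorem conv_smul_left (B : M →ₗ[k] N →ₗ[k] P) (c : k) (a : ℕ → M) (b : ℕ → N) :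
    conv B (c • a) b = c • conv B a b := by
  funext n; simp [conv, Finset.smul_sum]

theorem conv_smul_right (B : M →ₗ[k] N →ₗ[k] P) (c : k) (a : ℕ → M) (b : ℕ → N) :
    conv B a (c • b) = c • conv B a b := by
  funext n; simp [conv, Finset.smul_sum]

theorem conv_swap (B : M →ₗ[k] N →ₗ[k] P) (B' : N →ₗ[k] M →ₗ[k] P) (c : k)
    (H : ∀ x y, B x y = c • B' y x) (a : ℕ → M) (b : ℕ → N) :
    conv B a b = c • conv B' b a := by
  funext n
  simp only [conv, Pi.smul_apply, Finset.smul_sum]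
  rw [← Finset.Nat.sum_antidiagonal_swap]
  exact Finset.sum_congr rfl fun _ _ => H _ _

theorem sum_triple_left (f : ℕ → ℕ → ℕ → P) (n : ℕ) :
    ∑ x ∈ Finset.HasAntidiagonal.antidiagonal n, ∑ y ∈ Finset.HasAntidiagonal.antidiagonal x.1, f y.1 y.2 x.2
      = ∑ x ∈ Finset.HasAntidiagonal.antidiagonal n, ∑ y ∈ Finset.HasAntidiagonal.antidiagonal x.2, f x.1 y.1 y.2 := by
  simp only [Finset.sum_sigma']
  apply Finset.sum_nbij' (fun ⟨⟨_i, j⟩, ⟨k, l⟩⟩ ↦ ⟨(k, l + j), (l, j)⟩)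
    (fun ⟨⟨i, _j⟩, ⟨k, l⟩⟩ ↦ ⟨(i + k, l), (i, k)⟩) <;>
  · rintro ⟨⟨i, j⟩, ⟨p, q⟩⟩ h
    simp only [Finset.mem_sigma, Finset.HasAntidiagonal.mem_antidiagonal] at h
    obtain ⟨rfl, rfl⟩ := h
    simp [add_assoc, Finset.HasAntidiagonal.mem_antidiagonal]

theorem sum_triple_mid (f : ℕ → ℕ → ℕ → P) (n : ℕ) :
    ∑ x ∈ Finset.HasAntidiagonal.antidiagonal n, ∑ y ∈ Finset.HasAntidiagonal.antidiagonal x.2, f y.1 x.1 y.2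
      = ∑ x ∈ Finset.HasAntidiagonal.antidiagonal n, ∑ y ∈ Finset.HasAntidiagonal.antidiagonal x.2, f x.1 y.1 y.2 := by
  simp only [Finset.sum_sigma']
  apply Finset.sum_nbij' (fun ⟨⟨i, _j⟩, ⟨k, l⟩⟩ ↦ ⟨(k, i + l), (i, l)⟩)
    (fun ⟨⟨i, _j⟩, ⟨k, l⟩⟩ ↦ ⟨(k, i + l), (i, l)⟩) <;>
  · rintro ⟨⟨i, j⟩, ⟨p, q⟩⟩ h
    simp only [Finset.mem_sigma, Finset.HasAntidiagonal.mem_antidiagonal] at h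
    obtain ⟨rfl, rfl⟩ := h
    simp [add_left_comm, Finset.HasAntidiagonal.mem_antidiagonal]

theorem conv_jacobi (B₁ : M →ₗ[k] Q →ₗ[k] T) (B₂ : N →ₗ[k] P →ₗ[k] Q)
    (B₃ : R →ₗ[k] P →ₗ[k] T) (B₄ : M →ₗ[k] N →ₗ[k] R) (B₅ : N →ₗ[k] S →ₗ[k] T)
    (B₆ : M →ₗ[k] P →ₗ[k] S) (c : k)
    (H : ∀ x y z, B₁ x (B₂ y z) = B₃ (B₄ x y) z + c • B₅ y (B₆ x z))
    (a : ℕ → M) (b : ℕ → N) (e : ℕ → P) :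
    conv B₁ a (conv B₂ b e) = conv B₃ (conv B₄ a b) e + c • conv B₅ b (conv B₆ a e) := by
  funext n
  simp only [conv, Pi.add_apply, Pi.smul_apply, map_sum, LinearMap.sum_apply]
  rw [sum_triple_left (fun p q r => B₃ (B₄ (a p) (b q)) (e r)) n,
    sum_triple_mid (fun p q r => B₅ (b q) (B₆ (a p) (e r))) n]
  simp only [H, Finset.sum_add_distrib, Finset.smul_sum]

theorem map_conv (D : P →ₗ[k] Q) (B : M →ₗ[k] N →ₗ[k] P) (B₁ : R →ₗ[k] N →ₗ[k] Q)
    (D₁ : M →ₗ[k] R) (B₂ : M →ₗ[k] S →ₗ[k] Q) (D₂ : N →ₗ[k] S) (c : k)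
    (H : ∀ x y, D (B x y) = B₁ (D₁ x) y + c • B₂ x (D₂ y)) (a : ℕ → M) (b : ℕ → N) :
    (fun n => D (conv B a b n))
      = conv B₁ (fun n => D₁ (a n)) b + c • conv B₂ a (fun n => D₂ (b n)) := by
  funext n
  simp only [conv, Pi.add_apply, Pi.smul_apply, map_sum, H, Finset.sum_add_distrib,
    Finset.smul_sum]

/-- The coefficients of the derivative of `∑ a_p z^p`. -/
def coeffDeriv : (ℕ → M) →ₗ[k] (ℕ → M) where
  toFun a n := ((n : k) + 1) • a (n + 1)
  map_add' a b := by funext n; simp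
  map_smul' c a := by funext n; simp [smul_comm c]

theorem coeffDeriv_conv (B : M →ₗ[k] N →ₗ[k] P) (a : ℕ → M) (b : ℕ → N) :
    coeffDeriv (k := k) (conv B a b)
      = conv B (coeffDeriv (k := k) a) b + conv B a (coeffDeriv (k := k) b) := by
  funext n
  have h₁ : ∑ x ∈ Finset.HasAntidiagonal.antidiagonal (n + 1), (x.1 : k) • B (a x.1) (b x.2)
      = conv B (coeffDeriv (k := k) a) b n := by
    rw [Finset.Nat.sum_antidiagonal_succ]
    simp [conv, coeffDeriv]
  have h₂ : ∑ x ∈ Finset.HasAntidiagonal.antidiagonal (n + 1), (x.2 : k) • B (a x.1) (b x.2)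
      = conv B a (coeffDeriv (k := k) b) n := by
    rw [Finset.Nat.sum_antidiagonal_succ']
    simp [conv, coeffDeriv]
  rw [Pi.add_apply, ← h₁, ← h₂, ← Finset.sum_add_distrib]
  change ((n : k) + 1) • ∑ x ∈ Finset.HasAntidiagonal.antidiagonal (n + 1), B (a x.1) (b x.2) = _
  rw [Finset.smul_sum]
  refine Finset.sum_congr rfl fun x hx => ?_
  rw [← add_smul]
  congr 1
  have := Finset.HasAntidiagonal.mem_antidiagonal.1 hx
  rw [← Nat.cast_add, this, Nat.cast_succ]

end Convolution

section Path

variable (g : FilteredCurvedLieAlgebra.{u, v} k)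

/-- The sequences in `g` of degree `i` that tend to zero with respect to the filtration. -/
def nullSeq (i : ℤ) : Submodule k (ℕ → g.L i) where
  carrier := {a | ∀ n, ∃ N, ∀ p, N ≤ p → a p ∈ g.F n i}
  zero_mem' n := ⟨0, fun _ _ => (g.F n i).zero_mem⟩
  add_mem' := by
    intro a b ha hb n
    obtain ⟨N, hN⟩ := ha n
    obtain ⟨N', hN'⟩ := hb n
    exact ⟨N + N', fun p hp => (g.F n i).add_mem (hN p (by omega)) (hN' p (by omega))⟩
  smul_mem' := by
    intro c a ha n
    obtain ⟨N, hN⟩ := ha n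
    exact ⟨N, fun p hp => (g.F n i).smul_mem c (hN p hp)⟩

variable {g}

theorem F_zero (i : ℤ) : g.F 0 i = ⊤ :=
  top_le_iff.1 ((g.F_one i).symm.le.trans (g.F_anti 0 i))

theorem conv_mem {i j l : ℤ} (h : i + j = l) {a : ℕ → g.L i} {b : ℕ → g.L j}
    (ha : a ∈ nullSeq g i) (hb : b ∈ nullSeq g j) : conv (g.br h) a b ∈ nullSeq g l := by
  intro n
  obtain ⟨N, hN⟩ := ha n
  obtain ⟨N', hN'⟩ := hb n
  refine ⟨N + N', fun p hp => Submodule.sum_mem _ fun x hx => ?_⟩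
  have hx' := Finset.HasAntidiagonal.mem_antidiagonal.1 hx
  by_cases h1 : N ≤ x.1
  · exact g.br_mem (q := 0) h (hN _ h1) (by rw [F_zero]; trivial)
  · have := g.br_mem (p := 0) h (x := a x.1) (by rw [F_zero]; trivial) (hN' x.2 (by omega))
    rwa [Nat.zero_add] at this

theorem d_comp_mem {i j : ℤ} (h : i + 1 = j) {a : ℕ → g.L i} (ha : a ∈ nullSeq g i) :
    (g.d h).compLeft ℕ a ∈ nullSeq g j := by
  intro n
  obtain ⟨N, hN⟩ := ha n
  exact ⟨N, fun p hp => g.d_mem h (hN p hp)⟩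

theorem coeffDeriv_mem {i : ℤ} {a : ℕ → g.L i} (ha : a ∈ nullSeq g i) :
    coeffDeriv (k := k) a ∈ nullSeq g i := by
  intro n
  obtain ⟨N, hN⟩ := ha n
  exact ⟨N, fun p hp => (g.F n i).smul_mem _ (hN (p + 1) (by omega))⟩

variable (g)

/-- The degree `i` part of the completed tensor product
`g[z, dz] = lim_n (g / F n) ⊗ k[z, dz]`.  The pair `(a, b)` stands for
`∑ a_p z^p + ∑ b_p z^p dz`; modulo every `F n` it is a polynomial. -/
abbrev PathL (i : ℤ) : Type v := nullSeq g i × nullSeq g (i - 1)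

theorem sgn_add (i j : ℤ) : (-1 : k) ^ (i + j) = (-1 : k) ^ i * (-1 : k) ^ j :=
  zpow_add₀ (neg_ne_zero.2 one_ne_zero) i j

theorem sgn_sub (i j : ℤ) : (-1 : k) ^ (i - j) = (-1 : k) ^ i * (-1 : k) ^ j := by
  rw [zpow_sub₀ (neg_ne_zero.2 one_ne_zero), div_eq_mul_inv, ← inv_zpow]
  norm_num

theorem sgn_or (i : ℤ) : (-1 : k) ^ i = 1 ∨ (-1 : k) ^ i = -1 := by
  rcases Int.even_or_odd i with h | h
  · exact Or.inl h.neg_one_zpow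
  · exact Or.inr h.neg_one_zpow

/-- The bracket of `g[z, dz]`: the bracket of `g` extended bilinearly over the graded commutative
algebra `k[z, dz]`, so that `[b z^q dz, a z^p] = (-1)^{|a|} [b, a] z^{p+q} dz`. -/
def pathBr {i j l : ℤ} (h : i + j = l) : PathL g i →ₗ[k] PathL g j →ₗ[k] PathL g l :=
  LinearMap.mk₂ k
    (fun x y =>
      (⟨conv (g.br h) x.1 y.1, conv_mem h x.1.2 y.1.2⟩,
       ⟨conv (g.br (show i + (j - 1) = l - 1 by omega)) x.1 y.2
          + (-1 : k) ^ j • conv (g.br (show i - 1 + j = l - 1 by omega)) x.2 y.1,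
        Submodule.add_mem _ (conv_mem _ x.1.2 y.2.2)
          (Submodule.smul_mem _ _ (conv_mem _ x.2.2 y.1.2))⟩))
    (by
      intro x x' y
      refine Prod.ext (Subtype.ext ?_) (Subtype.ext ?_)
      · simp [conv_add_left]
      · simp only [Prod.fst_add, Prod.snd_add, Submodule.coe_add, conv_add_left]
        module)
    (by
      intro c x y
      refine Prod.ext (Subtype.ext ?_) (Subtype.ext ?_)
      · simp [conv_smul_left]
      · simp only [Prod.smul_fst, Prod.smul_snd, Submodule.coe_smul, conv_smul_left]
        module)
    (by
      intro x y y'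
      refine Prod.ext (Subtype.ext ?_) (Subtype.ext ?_)
      · simp [conv_add_right]
      · simp only [Prod.fst_add, Prod.snd_add, Submodule.coe_add, conv_add_right]
        module)
    (by
      intro c x y
      refine Prod.ext (Subtype.ext ?_) (Subtype.ext ?_)
      · simp [conv_smul_right]
      · simp only [Prod.smul_fst, Prod.smul_snd, Submodule.coe_smul, conv_smul_right]
        module)

/-- The identification of two homogeneous components whose degrees are equal. -/
def castL {i j : ℤ} (h : i = j) : g.L i →ₗ[k] g.L j := h ▸ LinearMap.id

variable {g}

theorem castL_mem {i j : ℤ} (h : i = j) {n : ℕ} {x : g.L i} (hx : x ∈ g.F n i) :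
    castL g h x ∈ g.F n j := by subst h; exact hx

theorem castL_br {i j l l' : ℤ} (h : l = l') (e : i + j = l) (e' : i + j = l') (x : g.L i)
    (y : g.L j) : castL g h (g.br e x y) = g.br e' x y := by subst h; rfl

theorem br_castL_left {i i' j l : ℤ} (h : i = i') (e : i' + j = l) (e' : i + j = l) (x : g.L i)
    (y : g.L j) : g.br e (castL g h x) y = g.br e' x y := by subst h; rfl

theorem br_castL_right {i j j' l : ℤ} (h : j = j') (e : i + j' = l) (e' : i + j = l) (x : g.L i)
    (y : g.L j) : g.br e x (castL g h y) = g.br e' x y := by subst h; rfl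

theorem castL_d {i j j' : ℤ} (h : j = j') (e : i + 1 = j) (e' : i + 1 = j') (x : g.L i) :
    castL g h (g.d e x) = g.d e' x := by subst h; rfl

theorem d_castL {i i' j : ℤ} (h : i = i') (e : i' + 1 = j) (e' : i + 1 = j) (x : g.L i) :
    g.d e (castL g h x) = g.d e' x := by subst h; rfl

variable (g)

/-- The predifferential of `g[z, dz]`: `d (a z^p) = (d a) z^p + (-1)^{|a|} p a z^{p-1} dz` and
`d (b z^p dz) = (d b) z^p dz`. -/
def pathD {i j : ℤ} (h : i + 1 = j) : PathL g i →ₗ[k] PathL g j where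
  toFun x :=
    (⟨(g.d h).compLeft ℕ x.1, d_comp_mem h x.1.2⟩,
     ⟨(g.d (show i - 1 + 1 = j - 1 by omega)).compLeft ℕ x.2
        + (-1 : k) ^ i • (castL g (show i = j - 1 by omega)).compLeft ℕ
            (coeffDeriv (k := k) (x.1 : ℕ → g.L i)),
      Submodule.add_mem _ (d_comp_mem _ x.2.2) (Submodule.smul_mem _ _ (fun n => by
        obtain ⟨N, hN⟩ := coeffDeriv_mem x.1.2 n
        exact ⟨N, fun p hp => castL_mem _ (hN p hp)⟩))⟩)
  map_add' x y := by
    refine Prod.ext (Subtype.ext ?_) (Subtype.ext ?_)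
    · simp
    · simp only [Prod.fst_add, Prod.snd_add, Submodule.coe_add, map_add]
      module
  map_smul' c x := by
    refine Prod.ext (Subtype.ext ?_) (Subtype.ext ?_)
    · simp
    · simp only [Prod.smul_fst, Prod.smul_snd, Submodule.coe_smul, map_smul, RingHom.id_apply]
      module

/-- The curvature `Ω ⊗ 1` of `g[z, dz]`. -/
def pathΩ : PathL g 2 :=
  (⟨Pi.single 0 g.Ω, fun n => ⟨1, fun p hp => by
    rw [Pi.single_eq_of_ne (by omega)]; exact (g.F n 2).zero_mem⟩⟩, 0)

theorem conv_single_left {i j l : ℤ} (h : i + j = l) (x : g.L i) (b : ℕ → g.L j) (n : ℕ) :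
    conv (g.br h) (Pi.single 0 x) b n = g.br h x (b n) := by
  unfold conv
  rw [Finset.sum_eq_single (0, n)]
  · simp
  · rintro ⟨p, q⟩ hpq hne
    have := Finset.HasAntidiagonal.mem_antidiagonal.1 hpq
    have hp : p ≠ 0 := by
      rintro rfl
      exact hne (by simpa using this)
    simp [Pi.single_eq_of_ne hp]
  · intro hn
    exact absurd (Finset.HasAntidiagonal.mem_antidiagonal.2 (by simp)) hn

/-- The curved Lie algebra `g[z, dz]`. -/
def pathAlgebra : CurvedLieAlgebra.{u, v} k where
  L := PathL g
  br := pathBr g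
  d := pathD g
  Ω := pathΩ g
  br_antisymm {i j l} h h' x y := by
    refine Prod.ext (Subtype.ext ?_) (Subtype.ext ?_)
    · have := conv_swap (g.br h) (g.br h') (-(-1 : k) ^ (i * j))
        (fun x y => by rw [g.br_antisymm h h']; module) x.1 y.1
      simpa [pathBr] using this
    · have e₁ := conv_swap (g.br (show i + (j - 1) = l - 1 by omega))
        (g.br (show j - 1 + i = l - 1 by omega)) (-(-1 : k) ^ (i * (j - 1)))
        (fun x y => by rw [g.br_antisymm _ (show j - 1 + i = l - 1 by omega)]; module) x.1 y.2
      have e₂ := conv_swap (g.br (show i - 1 + j = l - 1 by omega))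
        (g.br (show j + (i - 1) = l - 1 by omega)) (-(-1 : k) ^ ((i - 1) * j))
        (fun x y => by rw [g.br_antisymm _ (show j + (i - 1) = l - 1 by omega)]; module) x.2 y.1
      simp only [pathBr, LinearMap.mk₂_apply, Prod.snd_neg, Prod.smul_snd, Submodule.coe_neg,
        Submodule.coe_smul, e₁, e₂, sub_mul, mul_sub, sgn_sub, one_mul, mul_one]
      rcases sgn_or (k := k) j with hj | hj <;> simp only [hj] <;> module
  jacobi {i j m jm ij im t} h₁ h₂ h₃ h₄ h₅ h₆ x y z := by
    refine Prod.ext (Subtype.ext ?_) (Subtype.ext ?_)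
    · exact conv_jacobi _ _ _ _ _ _ _ (g.jacobi h₁ h₂ h₃ h₄ h₅ h₆) x.1 y.1 z.1
    · have e₁ := conv_jacobi _ _ _ _ _ _ _ (g.jacobi (show j + (m - 1) = jm - 1 by omega)
        (show i + (jm - 1) = t - 1 by omega) h₃ (show ij + (m - 1) = t - 1 by omega)
        (show i + (m - 1) = im - 1 by omega) (show j + (im - 1) = t - 1 by omega)) x.1 y.1 z.2
      have e₂ := conv_jacobi _ _ _ _ _ _ _ (g.jacobi (show (j - 1) + m = jm - 1 by omega)
        (show i + (jm - 1) = t - 1 by omega) (show i + (j - 1) = ij - 1 by omega)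
        (show (ij - 1) + m = t - 1 by omega) h₅
        (show (j - 1) + im = t - 1 by omega)) x.1 y.2 z.1
      have e₃ := conv_jacobi _ _ _ _ _ _ _ (g.jacobi h₁
        (show (i - 1) + jm = t - 1 by omega) (show (i - 1) + j = ij - 1 by omega)
        (show (ij - 1) + m = t - 1 by omega) (show (i - 1) + m = im - 1 by omega)
        (show j + (im - 1) = t - 1 by omega)) x.2 y.1 z.1
      subst h₁ h₃ h₅
      simp only [pathBr, LinearMap.mk₂_apply, Prod.snd_add, Prod.smul_snd, Submodule.coe_add,
        Submodule.coe_smul, conv_add_left, conv_add_right, conv_smul_left, conv_smul_right,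
        e₁, e₂, e₃, sub_mul, mul_sub, sgn_sub, sgn_add, one_mul, mul_one, smul_add]
      rcases sgn_or (k := k) j with hj | hj <;> rcases sgn_or (k := k) m with hm | hm <;>
        simp only [hj, hm] <;> module
  leibniz {i j l i' j' l'} h hl hi hj h₁ h₂ x y := by
    refine Prod.ext (Subtype.ext ?_) (Subtype.ext ?_)
    · exact map_conv _ _ _ _ _ _ _ (g.leibniz h hl hi hj h₁ h₂) x.1 y.1
    · have e₁ := map_conv _ _ _ _ _ _ _ (g.leibniz (show i + (j - 1) = l - 1 by omega)
        (show l - 1 + 1 = l' - 1 by omega) hi (show j - 1 + 1 = j' - 1 by omega)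
        (show i' + (j - 1) = l' - 1 by omega) (show i + (j' - 1) = l' - 1 by omega)) x.1 y.2
      have e₂ := map_conv _ _ _ _ _ _ _ (g.leibniz (show i - 1 + j = l - 1 by omega)
        (show l - 1 + 1 = l' - 1 by omega) (show i - 1 + 1 = i' - 1 by omega) hj
        (show i' - 1 + j = l' - 1 by omega) (show i - 1 + j' = l' - 1 by omega)) x.2 y.1
      have e₃ : (castL g (show l = l' - 1 by omega)).compLeft ℕ
          (coeffDeriv (k := k) (conv (g.br h) (x.1 : ℕ → g.L i) y.1))
          = conv (g.br (show i' - 1 + j = l' - 1 by omega))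
              ((castL g (show i = i' - 1 by omega)).compLeft ℕ (coeffDeriv (k := k) x.1)) y.1
            + conv (g.br (show i + (j' - 1) = l' - 1 by omega)) x.1
              ((castL g (show j = j' - 1 by omega)).compLeft ℕ (coeffDeriv (k := k) y.1)) := by
        rw [coeffDeriv_conv, map_add]
        congr 1
        · funext n
          simp only [conv, LinearMap.compLeft_apply, Function.comp_apply, map_sum]
          refine Finset.sum_congr rfl fun p _ => ?_
          rw [castL_br _ _ (show i + j = l' - 1 by omega),
            br_castL_left _ _ (show i + j = l' - 1 by omega)]
        · funext n
          simp only [conv, LinearMap.compLeft_apply, Function.comp_apply, map_sum]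
          refine Finset.sum_congr rfl fun p _ => ?_
          rw [castL_br _ _ (show i + j = l' - 1 by omega),
            br_castL_right _ _ (show i + j = l' - 1 by omega)]
      have e₁' : (g.d (show l - 1 + 1 = l' - 1 by omega)).compLeft ℕ
          (conv (g.br (show i + (j - 1) = l - 1 by omega)) (x.1 : ℕ → g.L i) y.2) = _ := e₁
      have e₂' : (g.d (show l - 1 + 1 = l' - 1 by omega)).compLeft ℕ
          (conv (g.br (show i - 1 + j = l - 1 by omega)) (x.2 : ℕ → g.L (i - 1)) y.1) = _ := e₂
      have c₁ : ∀ {i j : ℤ} (e : i + 1 = j) (a : ℕ → g.L i),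
        (g.d e).compLeft ℕ a = fun n => g.d e (a n) := fun _ _ => rfl
      simp only [pathBr, pathD, LinearMap.mk₂_apply, LinearMap.coe_mk, AddHom.coe_mk,
        Prod.snd_add, Prod.smul_snd, Submodule.coe_add, Submodule.coe_smul, map_add, map_smul,
        conv_add_left, conv_add_right, conv_smul_left, conv_smul_right, e₁', e₂', e₃]
      subst h hi hj
      simp only [c₁, sgn_sub, sgn_add, zpow_one]
      rcases sgn_or (k := k) j with hj | hj <;> rcases sgn_or (k := k) i with hm | hm <;>
        simp only [hj, hm] <;> module
  d_d {i j l} h h' h₂ x := by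
    refine Prod.ext (Subtype.ext ?_) (Subtype.ext ?_)
    · funext n
      refine (g.d_d h h' h₂ _).trans ?_
      exact (conv_single_left g h₂ g.Ω _ n).symm
    · funext n
      have e₁ := g.d_d (show i - 1 + 1 = j - 1 by omega) (show j - 1 + 1 = l - 1 by omega)
        (show 2 + (i - 1) = l - 1 by omega) ((x.2 : ℕ → g.L (i - 1)) n)
      have e₂ := conv_single_left g (show 2 + (i - 1) = l - 1 by omega) g.Ω
        (x.2 : ℕ → g.L (i - 1)) n
      have e₃ : g.d (show j - 1 + 1 = l - 1 by omega) (castL g (show i = j - 1 by omega)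
          ((x.1 : ℕ → g.L i) (n + 1))) = castL g (show j = l - 1 by omega)
          (g.d h ((x.1 : ℕ → g.L i) (n + 1))) := by
        rw [d_castL _ _ (show i + 1 = l - 1 by omega), castL_d _ _ (show i + 1 = l - 1 by omega)]
      have e₄ : (-1 : k) ^ j = -(-1 : k) ^ i := by rw [← h, sgn_add]; simp
      simp [pathBr, pathD, pathΩ, coeffDeriv, e₁, e₂, e₃, e₄, conv_zero_left]
  d_Ω := by
    refine Prod.ext (Subtype.ext ?_) (Subtype.ext ?_)
    · funext n
      rcases n with _ | n
      · simp [pathD, pathΩ, g.d_Ω]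
      · simp [pathD, pathΩ]
    · funext n
      simp [pathD, pathΩ, coeffDeriv]

variable {g}

/-- `f|_{z = t} = η` for `f ∈ g[z, dz]` and a scalar `t`: `dz` is sent to zero and the (convergent)
series `∑ t^p a_p` has the sum `η`. -/
def EvalsTo {i : ℤ} (f : (pathAlgebra g).L i) (t : k) (η : g.L i) : Prop :=
  ∀ n, ∃ N, ∀ m, N ≤ m → (∑ p ∈ Finset.range m, t ^ p • (f.1 : ℕ → g.L i) p) - η ∈ g.F n i

end Path

/-! ## The Maurer–Cartan moduli set -/

section Moduli

variable (g : FilteredCurvedLieAlgebra.{u, v} k)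

/-- Two Maurer–Cartan elements `ξ, η` of `g` are homotopic if there is a Maurer–Cartan element `h` of
`g[z, dz]` with `h|_{z = 0} = ξ` and `h|_{z = 1} = η`. -/
def Homotopic (ξ η : g.MC) : Prop :=
  ∃ h : (pathAlgebra g).MC, EvalsTo h.1 0 ξ.1 ∧ EvalsTo h.1 1 η.1

/-- The Maurer–Cartan moduli set: the set of equivalence classes of Maurer–Cartan elements for the
equivalence relation generated by homotopy. -/
def ModuliMC : Type v := Quot (Homotopic g)

variable {g} {h : FilteredCurvedLieAlgebra.{u, v} k}

theorem CurvedLieHom.isMC {a b : CurvedLieAlgebra.{u, v} k} (θ : CurvedLieHom a b) {ξ : a.L 1}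
    (hξ : a.IsMC ξ) : b.IsMC (θ.f 1 ξ) := by
  have := congrArg (θ.f 2) hξ
  simpa [CurvedLieAlgebra.IsMC, θ.map_br, θ.map_d, θ.map_Ω] using this

/-- The map on Maurer–Cartan elements induced by a morphism. -/
def CurvedLieHom.mapMC {a b : CurvedLieAlgebra.{u, v} k} (θ : CurvedLieHom a b) (ξ : a.MC) : b.MC :=
  ⟨θ.f 1 ξ.1, θ.isMC ξ.2⟩

namespace FilteredCurvedLieHom

variable (θ : FilteredCurvedLieHom g h)

theorem map_nullSeq {i : ℤ} {a : ℕ → g.L i} (ha : a ∈ nullSeq g i) :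
    (θ.f i).compLeft ℕ a ∈ nullSeq h i := by
  intro n
  obtain ⟨N, hN⟩ := ha n
  exact ⟨N, fun p hp => θ.map_F (hN p hp)⟩

theorem map_conv_br {i j l : ℤ} (e : i + j = l) (a : ℕ → g.L i) (b : ℕ → g.L j) :
    (θ.f l).compLeft ℕ (conv (g.br e) a b)
      = conv (h.br e) ((θ.f i).compLeft ℕ a) ((θ.f j).compLeft ℕ b) := by
  funext n
  simp [conv, θ.map_br]

theorem map_castL {i j : ℤ} (e : i = j) (x : g.L i) :
    θ.f j (castL g e x) = castL h e (θ.f i x) := by subst e; rfl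

/-- The morphism `g[z, dz] → h[z, dz]` induced by `θ`. -/
def pathMap : CurvedLieHom (pathAlgebra g) (pathAlgebra h) where
  f i := LinearMap.prodMap
    (((θ.f i).compLeft ℕ).restrict (fun _ ha => θ.map_nullSeq ha))
    (((θ.f (i - 1)).compLeft ℕ).restrict (fun _ ha => θ.map_nullSeq ha))
  map_br {i j l} e x y := by
    refine Prod.ext (Subtype.ext ?_) (Subtype.ext ?_)
    · exact θ.map_conv_br e x.1 y.1
    · refine ((LinearMap.compLeft (θ.f _) ℕ).map_add _ _).trans ?_
      refine congrArg₂ (· + ·) (θ.map_conv_br (show i + (j - 1) = l - 1 by omega) x.1 y.2) ?_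
      refine ((LinearMap.compLeft (θ.f _) ℕ).map_smul _ _).trans ?_
      exact congrArg _ (θ.map_conv_br (show i - 1 + j = l - 1 by omega) x.2 y.1)
  map_d {i j} e x := by
    refine Prod.ext (Subtype.ext ?_) (Subtype.ext ?_)
    · funext n
      exact θ.map_d e _
    · funext n
      refine ((θ.f (j - 1)).map_add _ _).trans ?_
      refine congrArg₂ (· + ·) (θ.map_d _ _) ?_
      refine ((θ.f (j - 1)).map_smul _ _).trans (congrArg _ ?_)
      refine (θ.map_castL _ _).trans (congrArg _ ?_)
      exact (θ.f i).map_smul _ _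
  map_Ω := by
    refine Prod.ext (Subtype.ext ?_) (Subtype.ext ?_)
    · funext n
      rcases n with _ | n
      · exact θ.map_Ω
      · exact (θ.f 2).map_zero
    · funext n
      exact (θ.f (2 - 1)).map_zero

theorem evalsTo {i : ℤ} {f : (pathAlgebra g).L i} {t : k} {η : g.L i} (H : EvalsTo f t η) :
    EvalsTo (θ.pathMap.f i f) t (θ.f i η) := by
  intro n
  obtain ⟨N, hN⟩ := H n
  refine ⟨N, fun m hm => ?_⟩
  have := θ.map_F (hN m hm)
  rw [map_sub, map_sum] at this
  simp only [map_smul] at this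
  exact this

/-- The map `𝓜𝓒(g) → 𝓜𝓒(h)`, `[ξ] ↦ [θ(ξ)]`, induced by `θ`. -/
def mapModuliMC : ModuliMC g → ModuliMC h :=
  Quot.map θ.mapMC (by
    rintro ξ η ⟨f, h₀, h₁⟩
    exact ⟨θ.pathMap.mapMC f, θ.evalsTo h₀, θ.evalsTo h₁⟩)

end FilteredCurvedLieHom

end Moduli

end CurvedLie

/-! Since `F 1` is everything, brackets and `d²` raise the filtration by one, so modulo `F (n + 1)`
the Maurer–Cartan equation is corrected by solving a linear equation in the complex `F n / F (n +
1)`.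

Call `φ` an acyclic fibration if it is surjective on every `F n` and its kernel has acyclic
associated graded. Any degree one lift of a Maurer–Cartan element has curvature in the kernel; by
the Bianchi identity, once the curvature lies in `F n` it is a cocycle modulo `F (n + 1)`.
Acyclicity removes it by a correction inside the kernel, and completeness sums the corrections
(`exists_isMC_of_acyclic`). So `φ` is surjective on Maurer–Cartan elements. The same argument in
`g[z, dz]`, relative to the two end points, lifts homotopies; the acyclicity needed there is
`IsAcyclicFibration.path_exact`. Together these give a bijection on moduli sets
(`IsAcyclicFibration.bijective_mapModuliMC`).

A general `θ` is treated as in Ken Brown's lemma. In the mapping path object of pairs (element `x`,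
path from `θ x`), `θ` is the section by constant paths followed by the end point map. The projection
to the source is always an acyclic fibration and has that section as right inverse, so the section
is bijective on moduli. The kernel of the end point map is a model of the homotopy fibre of `θ`,
hence graded acyclic when `θ` is a filtered quasi-isomorphism, so the end point map is bijective on
moduli too. -/

namespace CurvedLie

open CategoryTheory

variable {k : Type u} [Field k]

/-! ### Elementary estimates for the filtration. -/

section Filtration

variable {g : FilteredCurvedLieAlgebra.{u, v} k}

theorem F_le {m n : ℕ} (h : m ≤ n) (i : ℤ) : g.F n i ≤ g.F m i :=
  antitone_nat_of_succ_le (f := fun n => g.F n i) (fun n => g.F_anti n i) h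

theorem mem_F_one {i : ℤ} (x : g.L i) : x ∈ g.F 1 i := by rw [g.F_one]; trivial

theorem mem_F_zero {i : ℤ} (x : g.L i) : x ∈ g.F 0 i := by rw [F_zero]; trivial

theorem br_mem_left {n : ℕ} {i j l : ℤ} (h : i + j = l) {x : g.L i} (y : g.L j)
    (hx : x ∈ g.F n i) : g.br h x y ∈ g.F n l :=
  g.br_mem (q := 0) h hx (mem_F_zero y)

theorem br_mem_right {n : ℕ} {i j l : ℤ} (h : i + j = l) (x : g.L i) {y : g.L j}
    (hy : y ∈ g.F n j) : g.br h x y ∈ g.F n l := by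
  simpa using g.br_mem (p := 0) h (mem_F_zero x) hy

theorem br_mem_succ {n : ℕ} {i j l : ℤ} (h : i + j = l) (x : g.L i) {y : g.L j}
    (hy : y ∈ g.F n j) : g.br h x y ∈ g.F (n + 1) l := by
  rw [add_comm]
  exact g.br_mem h (mem_F_one x) hy

/-- Because `Ω` lies in `F 1`, `d` is a differential up to one filtration step. Every error term
`d²` below is absorbed this way. -/
theorem d_d_mem {n : ℕ} {i j l : ℤ} (h : i + 1 = j) (h' : j + 1 = l) {x : g.L i}
    (hx : x ∈ g.F n i) : g.d h' (g.d h x) ∈ g.F (n + 1) l := by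
  rw [g.d_d h h' (by omega)]
  exact br_mem_succ _ _ hx

theorem eq_of_sub_mem {i : ℤ} {x y : g.L i} (h : ∀ n, x - y ∈ g.F n i) : x = y :=
  sub_eq_zero.1 (g.hausdorff _ h)

end Filtration

/-! ### Convergent series and the sum of a null sequence. -/

section NullSequences

variable {g : FilteredCurvedLieAlgebra.{u, v} k}

theorem nullSeq_complete {i : ℤ} (x : ℕ → nullSeq g i)
    (hx : ∀ n p, (x (n + 1) : ℕ → g.L i) p - (x n : ℕ → g.L i) p ∈ g.F n i) :
    ∃ y : nullSeq g i, ∀ n p, (y : ℕ → g.L i) p - (x n : ℕ → g.L i) p ∈ g.F n i := by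
  choose y hy using fun p => g.complete (fun n => (x n : ℕ → g.L i) p) (fun n => hx n p)
  refine ⟨⟨y, fun n => ?_⟩, fun n p => hy p n⟩
  obtain ⟨N, hN⟩ := (x n).2 n
  exact ⟨N, fun p hp => by simpa using (g.F n i).add_mem (hy p n) (hN p hp)⟩

/-- The series `∑ a_p` converges to `η` with respect to the filtration. -/
def SumsTo {i : ℤ} (a : ℕ → g.L i) (η : g.L i) : Prop :=
  ∀ n, ∃ N, ∀ m, N ≤ m → (∑ p ∈ Finset.range m, a p) - η ∈ g.F n i

theorem sum_range_sub_mem {i : ℤ} {a : ℕ → g.L i} {n N m m' : ℕ}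
    (ha : ∀ p, N ≤ p → a p ∈ g.F n i) (hm : N ≤ m) (hm' : N ≤ m') :
    (∑ p ∈ Finset.range m, a p) - ∑ p ∈ Finset.range m', a p ∈ g.F n i := by
  have key : ∀ m, N ≤ m →
      (∑ p ∈ Finset.range m, a p) - ∑ p ∈ Finset.range N, a p ∈ g.F n i := by
    intro m hm
    rw [← Finset.sum_Ico_eq_sub _ hm]
    exact Submodule.sum_mem _ fun p hp => ha p (Finset.mem_Ico.1 hp).1
  simpa using (g.F n i).sub_mem (key m hm) (key m' hm')

/-- The topology is non-archimedean: the steps `F n` are subspaces, so null terms already make the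
partial sums Cauchy. -/
theorem exists_sumsTo {i : ℤ} {a : ℕ → g.L i} (ha : a ∈ nullSeq g i) : ∃ η, SumsTo a η := by
  choose N hN using ha
  obtain ⟨η, hη⟩ := g.complete (fun n => ∑ p ∈ Finset.range (N n), a p) (fun n => by
    rcases le_total (N n) (N (n + 1)) with h | h
    · exact sum_range_sub_mem (hN n) h le_rfl
    · exact g.F_anti _ _ (sum_range_sub_mem (hN (n + 1)) le_rfl h))
  refine ⟨η, fun n => ⟨N n, fun m hm => ?_⟩⟩
  have := (g.F n i).sub_mem (sum_range_sub_mem (hN n) hm le_rfl) (hη n)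
  simpa using this

theorem SumsTo.unique {i : ℤ} {a : ℕ → g.L i} {η η' : g.L i} (h : SumsTo a η)
    (h' : SumsTo a η') : η = η' := by
  refine eq_of_sub_mem fun n => ?_
  obtain ⟨N, hN⟩ := h n
  obtain ⟨N', hN'⟩ := h' n
  simpa using (g.F n i).sub_mem (hN' (N + N') (by omega)) (hN (N + N') (by omega))

theorem SumsTo.add {i : ℤ} {a b : ℕ → g.L i} {η ζ : g.L i} (h : SumsTo a η)
    (h' : SumsTo b ζ) : SumsTo (a + b) (η + ζ) := by
  intro n
  obtain ⟨N, hN⟩ := h n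
  obtain ⟨N', hN'⟩ := h' n
  refine ⟨N + N', fun m hm => ?_⟩
  have := (g.F n i).add_mem (hN m (by omega)) (hN' m (by omega))
  simp only [Pi.add_apply, Finset.sum_add_distrib]
  convert this using 1
  abel

theorem SumsTo.map {g' : FilteredCurvedLieAlgebra.{u, v} k} {i j : ℤ} (D : g.L i →ₗ[k] g'.L j)
    (hD : ∀ {n x}, x ∈ g.F n i → D x ∈ g'.F n j) {a : ℕ → g.L i} {η : g.L i} (h : SumsTo a η) :
    SumsTo (fun p => D (a p)) (D η) := by
  intro n
  obtain ⟨N, hN⟩ := h n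
  exact ⟨N, fun m hm => by simpa using hD (hN m hm)⟩

theorem SumsTo.smul {i : ℤ} (c : k) {a : ℕ → g.L i} {η : g.L i} (h : SumsTo a η) :
    SumsTo (c • a) (c • η) := by
  intro n
  obtain ⟨N, hN⟩ := h n
  refine ⟨N, fun m hm => ?_⟩
  have := (g.F n i).smul_mem c (hN m hm)
  rwa [smul_sub, Finset.smul_sum] at this

theorem sumsTo_single {i : ℤ} (p : ℕ) (η : g.L i) : SumsTo (Pi.single p η) η := by
  refine fun n => ⟨p + 1, fun m hm => ?_⟩
  rw [Finset.sum_eq_single p (fun q _ hq => Pi.single_eq_of_ne hq _)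
    (fun h => absurd (Finset.mem_range.2 (by omega)) h), Pi.single_eq_same, sub_self]
  exact Submodule.zero_mem _

theorem single_mem_nullSeq {i : ℤ} (p : ℕ) (η : g.L i) : Pi.single p η ∈ nullSeq g i :=
  fun n => ⟨p + 1, fun q hq => by
    rw [Pi.single_eq_of_ne (by omega)]; exact (g.F n i).zero_mem⟩

theorem SumsTo.mem {i : ℤ} {a : ℕ → g.L i} {η : g.L i} (h : SumsTo a η) {n : ℕ}
    (ha : ∀ p, a p ∈ g.F n i) : η ∈ g.F n i := by
  obtain ⟨N, hN⟩ := h n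
  simpa using (g.F n i).sub_mem (Submodule.sum_mem (t := Finset.range N) _ fun p _ => ha p)
    (hN N le_rfl)

/-- The Cauchy product: this makes evaluation at `z = 1` compatible with brackets. -/
theorem SumsTo.conv {i j l : ℤ} (e : i + j = l) {a : ℕ → g.L i} {b : ℕ → g.L j}
    (ha : a ∈ nullSeq g i) (hb : b ∈ nullSeq g j) {α : g.L i} {β : g.L j} (hα : SumsTo a α)
    (hβ : SumsTo b β) : SumsTo (conv (g.br e) a b) (g.br e α β) := by
  intro n
  obtain ⟨N₁, h₁⟩ := ha n
  obtain ⟨N₂, h₂⟩ := hb n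
  obtain ⟨N₃, h₃⟩ := hα n
  obtain ⟨N₄, h₄⟩ := hβ n
  refine ⟨N₁ + N₂ + N₃ + N₄, fun m hm => ?_⟩
  have e₁ : ∑ s ∈ Finset.range m, CurvedLie.conv (g.br e) a b s
      = ∑ p ∈ Finset.range m, g.br e (a p) (∑ q ∈ Finset.range (m - p), b q) := by
    simp only [map_sum]
    rw [← Finset.sum_range_diag_flip m fun p q => g.br e (a p) (b q)]
    exact Finset.sum_congr rfl fun s _ =>
      Finset.Nat.sum_antidiagonal_eq_sum_range_succ (fun p q => g.br e (a p) (b q)) s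
  -- Triangle against square, row by row: either `a p` is already in `F n`, or `p < N₁`, and then
  -- both `m - p` and `m` exceed `N₂`, so the two inner sums agree modulo `F n`.
  have e₂ : (∑ p ∈ Finset.range m, g.br e (a p) (∑ q ∈ Finset.range (m - p), b q))
      - g.br e (∑ p ∈ Finset.range m, a p) (∑ q ∈ Finset.range m, b q) ∈ g.F n l := by
    rw [map_sum (g.br e), LinearMap.sum_apply, ← Finset.sum_sub_distrib]
    refine Submodule.sum_mem _ fun p _ => ?_
    rw [← map_sub]
    by_cases hp : N₁ ≤ p
    · exact br_mem_left e _ (h₁ p hp)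
    · exact br_mem_right e _ (sum_range_sub_mem h₂ (by omega) (by omega))
  have e₃ := br_mem_left e (∑ q ∈ Finset.range m, b q) (h₃ m (by omega))
  have e₄ := br_mem_right e α (h₄ m (by omega))
  rw [e₁]
  have := (g.F n l).add_mem e₂ ((g.F n l).add_mem e₃ e₄)
  convert this using 1
  simp only [map_sub, LinearMap.sub_apply]
  abel

/-- The sum of a null sequence. -/
noncomputable def sumSeq (i : ℤ) : nullSeq g i →ₗ[k] g.L i where
  toFun a := Classical.choose (exists_sumsTo a.2)
  map_add' a b := by
    have h := Classical.choose_spec (exists_sumsTo (a + b).2)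
    have ha := Classical.choose_spec (exists_sumsTo a.2)
    have hb := Classical.choose_spec (exists_sumsTo b.2)
    exact SumsTo.unique h (ha.add hb)
  map_smul' c a := by
    have h := Classical.choose_spec (exists_sumsTo (c • a).2)
    have ha := Classical.choose_spec (exists_sumsTo a.2)
    exact SumsTo.unique h (ha.smul c)

theorem sumSeq_spec {i : ℤ} (a : nullSeq g i) : SumsTo (a : ℕ → g.L i) (sumSeq i a) :=
  Classical.choose_spec (exists_sumsTo a.2)

theorem SumsTo.sumSeq_eq {i : ℤ} {a : nullSeq g i} {η : g.L i} (h : SumsTo (a : ℕ → g.L i) η) :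
    sumSeq i a = η := (sumSeq_spec a).unique h

theorem evalsTo_one_iff {i : ℤ} {f : (pathAlgebra g).L i} {η : g.L i} :
    EvalsTo f 1 η ↔ sumSeq i f.1 = η := by
  have : EvalsTo f 1 η ↔ SumsTo (f.1 : ℕ → g.L i) η := by simp [EvalsTo, SumsTo]
  rw [this]
  exact ⟨fun h => h.sumSeq_eq, fun h => h ▸ sumSeq_spec _⟩

theorem evalsTo_zero_iff {i : ℤ} {f : (pathAlgebra g).L i} {η : g.L i} :
    EvalsTo f 0 η ↔ (f.1 : ℕ → g.L i) 0 = η := by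
  have key : ∀ m, 1 ≤ m →
      ∑ p ∈ Finset.range m, (0 : k) ^ p • (f.1 : ℕ → g.L i) p = (f.1 : ℕ → g.L i) 0 := by
    intro m hm
    rw [Finset.sum_eq_single 0 (fun p _ hp => by simp [hp])
      (fun h => absurd (Finset.mem_range.2 hm) h)]
    simp
  constructor
  · intro h
    refine eq_of_sub_mem fun n => ?_
    obtain ⟨N, hN⟩ := h n
    have := hN (N + 1) (by omega)
    rwa [key _ (by omega)] at this
  · rintro rfl n
    refine ⟨1, fun m hm => ?_⟩
    rw [key m hm, sub_self]
    exact Submodule.zero_mem _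

end NullSequences

/-! ### The path algebra as a filtered curved Lie algebra, its evaluations and constants. -/

section PathFiltered

variable (g : FilteredCurvedLieAlgebra.{u, v} k)

theorem conv_br_mem {p q : ℕ} {i j l : ℤ} (h : i + j = l) {a : ℕ → g.L i} {b : ℕ → g.L j}
    (ha : ∀ n, a n ∈ g.F p i) (hb : ∀ n, b n ∈ g.F q j) (n : ℕ) :
    conv (g.br h) a b n ∈ g.F (p + q) l :=
  Submodule.sum_mem _ fun _ _ => g.br_mem h (ha _) (hb _)

/-- The curved Lie algebra `g[z, dz]` with the filtration by the forms whose coefficients all lie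
in `F n`. -/
def pathFiltered : FilteredCurvedLieAlgebra.{u, v} k where
  toCurvedLieAlgebra := pathAlgebra g
  F n i :=
    { carrier := {x : PathL g i | (∀ p, (x.1 : ℕ → g.L i) p ∈ g.F n i) ∧
        ∀ p, (x.2 : ℕ → g.L (i - 1)) p ∈ g.F n (i - 1)}
      zero_mem' := ⟨fun _ => Submodule.zero_mem _, fun _ => Submodule.zero_mem _⟩
      add_mem' := fun hx hy => ⟨fun p => Submodule.add_mem _ (hx.1 p) (hy.1 p),
        fun p => Submodule.add_mem _ (hx.2 p) (hy.2 p)⟩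
      smul_mem' := fun c _ hx => ⟨fun p => Submodule.smul_mem _ c (hx.1 p),
        fun p => Submodule.smul_mem _ c (hx.2 p)⟩ }
  F_anti n i x hx := ⟨fun p => g.F_anti _ _ (hx.1 p), fun p => g.F_anti _ _ (hx.2 p)⟩
  F_one i := eq_top_iff.2 fun x _ => ⟨fun _ => mem_F_one _, fun _ => mem_F_one _⟩
  br_mem {p q i j l} h x y hx hy :=
    ⟨conv_br_mem g h hx.1 hy.1, fun n => Submodule.add_mem _
      (conv_br_mem g (show i + (j - 1) = l - 1 by omega) hx.1 hy.2 n)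
      (Submodule.smul_mem _ _ (conv_br_mem g (show i - 1 + j = l - 1 by omega) hx.2 hy.1 n))⟩
  d_mem {n i j} h x hx :=
    ⟨fun p => g.d_mem h (hx.1 p), fun p => Submodule.add_mem _ (g.d_mem _ (hx.2 p))
      (Submodule.smul_mem _ _ (castL_mem _ (Submodule.smul_mem _ _ (hx.1 (p + 1)))))⟩
  hausdorff {i} x hx := Prod.ext
    (Subtype.ext (funext fun p => g.hausdorff _ fun n => (hx n).1 p))
    (Subtype.ext (funext fun p => g.hausdorff _ fun n => (hx n).2 p))
  complete {i} x hx := by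
    obtain ⟨a, ha⟩ := nullSeq_complete (fun n => (x n).1) (fun n p => (hx n).1 p)
    obtain ⟨b, hb⟩ := nullSeq_complete (fun n => (x n).2) (fun n p => (hx n).2 p)
    exact ⟨(a, b), fun n => ⟨fun p => ha n p, fun p => hb n p⟩⟩

/-- Evaluation at `z = 0`. -/
def evZero : FilteredCurvedLieHom (pathFiltered g) g where
  f i := (LinearMap.proj 0).comp ((nullSeq g i).subtype.comp (LinearMap.fst k _ _))
  map_br {i j l} e x y := by
    change conv (g.br e) _ _ 0 = _
    simp [conv]
    rfl
  map_d e x := rfl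
  map_Ω := by
    change (Pi.single 0 g.Ω : ℕ → g.L 2) 0 = _
    simp
  map_F hx := hx.1 0

/-- Evaluation at `z = 1`. -/
noncomputable def evOne : FilteredCurvedLieHom (pathFiltered g) g where
  f i := (sumSeq i).comp (LinearMap.fst k _ _)
  map_br {i j l} e x y := by
    have h := SumsTo.conv e x.1.2 y.1.2 (sumSeq_spec x.1) (sumSeq_spec y.1)
    exact SumsTo.unique (sumSeq_spec (pathBr g e x y).1) h
  map_d {i j} e x := by
    have h := SumsTo.map (g.d e) (fun hx => g.d_mem e hx) (sumSeq_spec x.1)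
    exact SumsTo.unique (sumSeq_spec (pathD g e x).1) h
  map_Ω := SumsTo.unique (sumSeq_spec (pathΩ g).1) (sumsTo_single 0 g.Ω)
  map_F {n i x} hx := SumsTo.mem (sumSeq_spec x.1) hx.1

/-- The monomial `y z^p`. -/
def monomial (p : ℕ) (i : ℤ) : g.L i →ₗ[k] (pathFiltered g).L i where
  toFun y := (⟨Pi.single p y, single_mem_nullSeq p y⟩, 0)
  map_add' x y := Prod.ext (Subtype.ext (Pi.single_add (f := fun _ : ℕ => g.L i) p x y)) (add_zero 0).symm
  map_smul' c x := Prod.ext (Subtype.ext (Pi.single_smul (f := fun _ : ℕ => g.L i) p c x))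
    (smul_zero (A := nullSeq g (i - 1)) c).symm

/-- The inclusion of the constants. -/
def constPath : FilteredCurvedLieHom g (pathFiltered g) where
  f i := monomial g 0 i
  map_br {i j l} e x y := by
    refine Prod.ext (Subtype.ext ?_) (Subtype.ext ?_)
    · funext n
      refine Eq.trans ?_ (conv_single_left g e x _ n).symm
      change (Pi.single 0 (g.br e x y) : ℕ → g.L l) n = g.br e x ((Pi.single 0 y : ℕ → g.L j) n)
      rcases n with _ | n <;> simp
    · funext n
      change (0 : g.L (l - 1)) = conv (g.br (show i + (j - 1) = l - 1 by omega)) _ 0 n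
        + (-1 : k) ^ j • conv (g.br (show i - 1 + j = l - 1 by omega)) 0 _ n
      simp [conv]
  map_d {i j} e x := by
    refine Prod.ext (Subtype.ext ?_) (Subtype.ext ?_)
    · funext n
      change (Pi.single 0 (g.d e x) : ℕ → g.L j) n = g.d e ((Pi.single 0 x : ℕ → g.L i) n)
      rcases n with _ | n <;> simp
    · funext n
      change (0 : g.L (j - 1)) = g.d (show i - 1 + 1 = j - 1 by omega) 0
        + (-1 : k) ^ i • castL g (show i = j - 1 by omega) (((n : k) + 1) •
        (Pi.single 0 x : ℕ → g.L i) (n + 1))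
      simp
  map_Ω := rfl
  map_F {n i x} hx := by
    refine ⟨fun p => ?_, fun p => Submodule.zero_mem _⟩
    change (Pi.single 0 x : ℕ → g.L i) p ∈ _
    rcases p with _ | p <;> simp [hx]

variable {g}

theorem monomial_mem {n : ℕ} (p : ℕ) {i : ℤ} {x : g.L i} (hx : x ∈ g.F n i) :
    monomial g p i x ∈ (pathFiltered g).F n i := by
  refine ⟨fun q => ?_, fun q => Submodule.zero_mem _⟩
  change (Pi.single p x : ℕ → g.L i) q ∈ _
  by_cases h : q = p
  · subst h; simpa using hx
  · simp [Pi.single_eq_of_ne h]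

theorem evZero_const {i : ℤ} (x : g.L i) : (evZero g).f i ((constPath g).f i x) = x := by
  change (Pi.single 0 x : ℕ → g.L i) 0 = x
  simp

theorem evOne_const {i : ℤ} (x : g.L i) : (evOne g).f i ((constPath g).f i x) = x :=
  SumsTo.unique (sumSeq_spec (monomial g 0 i x).1) (sumsTo_single 0 x)

theorem evZero_monomial {i : ℤ} (x : g.L i) : (evZero g).f i (monomial g 1 i x) = 0 := by
  change (Pi.single 1 x : ℕ → g.L i) 0 = 0
  simp

theorem evOne_monomial {i : ℤ} (x : g.L i) : (evOne g).f i (monomial g 1 i x) = x :=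
  SumsTo.unique (sumSeq_spec (monomial g 1 i x).1) (sumsTo_single 1 x)

end PathFiltered

/-! ### Integration along the interval and the Poincaré lemma. -/

section Integration

variable {g : FilteredCurvedLieAlgebra.{u, v} k}

theorem castL_mem_iff {i j : ℤ} (h : i = j) {n : ℕ} {x : g.L i} :
    castL g h x ∈ g.F n j ↔ x ∈ g.F n i := by subst h; rfl

theorem castL_castL {i j : ℤ} (h : i = j) (h' : j = i) (x : g.L i) :
    castL g h' (castL g h x) = x := by subst h; rfl

/-- The coefficients of a primitive of `∑ b_p z^p dz`, with the sign which makes it a primitive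
for the predifferential of `g[z, dz]`. -/
def primitiveSeq {i j : ℤ} (h : i + 1 = j) (b : ℕ → g.L (j - 1)) : ℕ → g.L i
  | 0 => 0
  | n + 1 => (-1 : k) ^ i • ((n : k) + 1)⁻¹ • castL g (show j - 1 = i by omega) (b n)

theorem primitiveSeq_mem {i j : ℤ} (h : i + 1 = j) {n : ℕ} {b : ℕ → g.L (j - 1)}
    (hb : ∀ p, b p ∈ g.F n (j - 1)) (p : ℕ) : primitiveSeq h b p ∈ g.F n i := by
  rcases p with _ | p
  · exact Submodule.zero_mem _
  · exact Submodule.smul_mem _ _ (Submodule.smul_mem _ _ (castL_mem _ (hb p)))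

theorem primitiveSeq_mem_nullSeq {i j : ℤ} (h : i + 1 = j) {b : ℕ → g.L (j - 1)}
    (hb : b ∈ nullSeq g (j - 1)) : primitiveSeq h b ∈ nullSeq g i := by
  intro n
  obtain ⟨N, hN⟩ := hb n
  refine ⟨N + 1, fun p hp => ?_⟩
  obtain ⟨p, rfl⟩ : ∃ q, p = q + 1 := ⟨p - 1, by omega⟩
  exact Submodule.smul_mem _ _ (Submodule.smul_mem _ _ (castL_mem _ (hN p (by omega))))

/-- Integration from `z = 0` along the interval. -/
def primitive {i j : ℤ} (h : i + 1 = j) (x : (pathFiltered g).L j) : (pathFiltered g).L i :=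
  (⟨primitiveSeq h (x.2 : ℕ → g.L (j - 1)), primitiveSeq_mem_nullSeq h x.2.2⟩, 0)

theorem primitive_mem {i j : ℤ} (h : i + 1 = j) {n : ℕ} {x : (pathFiltered g).L j}
    (hx : x ∈ (pathFiltered g).F n j) : primitive h x ∈ (pathFiltered g).F n i :=
  ⟨primitiveSeq_mem h hx.2, fun _ => Submodule.zero_mem _⟩

theorem evZero_primitive {i j : ℤ} (h : i + 1 = j) (x : (pathFiltered g).L j) :
    (evZero g).f i (primitive h x) = 0 := rfl

/-- The `dz` part of `d` differentiates with sign `(-1)^i`, which cancels the sign and the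
denominators built into the primitive. Characteristic zero is needed to divide by `n + 1`. -/
theorem d_primitive_snd [CharZero k] {i j : ℤ} (h : i + 1 = j) (x : (pathFiltered g).L j) :
    ((pathFiltered g).d h (primitive h x)).2 = x.2 := by
  refine Subtype.ext (funext fun n => ?_)
  change g.d (show i - 1 + 1 = j - 1 by omega) 0 + (-1 : k) ^ i • castL g _ (((n : k) + 1) •
    (-1 : k) ^ i • ((n : k) + 1)⁻¹ • castL g _ ((x.2 : ℕ → g.L (j - 1)) n)) = _
  have hn : (n : k) + 1 ≠ 0 := Nat.cast_add_one_ne_zero n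
  rw [map_zero, zero_add, map_smul, map_smul, map_smul, castL_castL, smul_comm ((n : k) + 1),
    smul_smul ((n : k) + 1), mul_inv_cancel₀ hn, one_smul, smul_smul]
  rcases sgn_or (k := k) i with hi | hi <;> simp [hi]

/-- The Poincaré lemma for the interval on the associated graded level. -/
theorem sub_d_primitive_mem [CharZero k] {i j l : ℤ} (h : i + 1 = j) (h' : j + 1 = l) {n : ℕ}
    {x : (pathFiltered g).L j} (hx : x ∈ (pathFiltered g).F n j)
    (hdx : (pathFiltered g).d h' x ∈ (pathFiltered g).F (n + 1) l) :
    x - (pathFiltered g).d h (primitive h x) - (constPath g).f j ((evZero g).f j x)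
      ∈ (pathFiltered g).F (n + 1) j := by
  -- The remainder `r` has no `dz` part, and `d r` is still in `F (n + 1)`. The `dz` coefficients of
  -- `d r` are then `±(q + 1) r_{q+1}`, which forces every positive coefficient of `r` into `F (n +
  -- 1)`; only the constant term `x|_{z = 0}` survives.
  obtain ⟨r, hr⟩ : ∃ r, r = x - (pathFiltered g).d h (primitive h x) := ⟨_, rfl⟩
  have hr2 : r.2 = 0 := by
    rw [hr]
    exact sub_eq_zero.2 (d_primitive_snd h x).symm
  have hdr : (pathFiltered g).d h' r ∈ (pathFiltered g).F (n + 1) l := by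
    rw [hr, map_sub]
    exact Submodule.sub_mem _ hdx (d_d_mem _ _ (primitive_mem h hx))
  have hr0 : (r.1 : ℕ → g.L j) 0 = (x.1 : ℕ → g.L j) 0 := by
    have : (evZero g).f j r = (evZero g).f j x := by
      rw [hr, map_sub, (evZero g).map_d, evZero_primitive, map_zero, sub_zero]
    exact this
  rw [← hr]
  refine ⟨fun q => ?_, fun q => ?_⟩
  · change (r.1 : ℕ → g.L j) q - (Pi.single 0 ((x.1 : ℕ → g.L j) 0) : ℕ → g.L j) q ∈ _
    rcases q with _ | q
    · simp [hr0]
    · have hq := hdr.2 q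
      change g.d (show j - 1 + 1 = l - 1 by omega) ((r.2 : ℕ → g.L (j - 1)) q) + (-1 : k) ^ j •
        castL g (show j = l - 1 by omega) (((q : k) + 1) • (r.1 : ℕ → g.L j) (q + 1)) ∈ _ at hq
      have hj : (-1 : k) ^ j ≠ 0 := zpow_ne_zero _ (neg_ne_zero.2 one_ne_zero)
      rw [hr2, ZeroMemClass.coe_zero, Pi.zero_apply, map_zero, zero_add,
        Submodule.smul_mem_iff _ hj, castL_mem_iff,
        Submodule.smul_mem_iff _ (Nat.cast_add_one_ne_zero q)] at hq
      simpa using hq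
  · change (r.2 : ℕ → g.L (j - 1)) q - 0 ∈ _
    rw [hr2]
    simp

end Integration

/-! ### Functoriality of moduli sets, paths and integration. -/

namespace FilteredCurvedLieHom

variable {g h l : FilteredCurvedLieAlgebra.{u, v} k}

/-- The morphism `g[z, dz] → h[z, dz]` induced by `θ` preserves the filtrations. -/
def pathFiltered (θ : FilteredCurvedLieHom g h) :
    FilteredCurvedLieHom (pathFiltered g) (pathFiltered h) where
  toCurvedLieHom := θ.pathMap
  map_F hx := ⟨fun p => θ.map_F (hx.1 p), fun p => θ.map_F (hx.2 p)⟩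

/-- The composition of morphisms. -/
def comp (φ : FilteredCurvedLieHom h l) (θ : FilteredCurvedLieHom g h) :
    FilteredCurvedLieHom g l where
  f i := (φ.f i).comp (θ.f i)
  map_br e x y := by simp [θ.map_br, φ.map_br]
  map_d e x := by simp [θ.map_d, φ.map_d]
  map_Ω := by simp [θ.map_Ω, φ.map_Ω]
  map_F hx := φ.map_F (θ.map_F hx)

theorem mapModuliMC_comp (φ : FilteredCurvedLieHom h l) (θ : FilteredCurvedLieHom g h) :
    (φ.comp θ).mapModuliMC = φ.mapModuliMC ∘ θ.mapModuliMC := by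
  funext x
  obtain ⟨x, rfl⟩ := Quot.exists_rep x
  rfl

theorem mapModuliMC_eq_id (θ : FilteredCurvedLieHom g g) (hθ : ∀ x, θ.f 1 x = x) :
    θ.mapModuliMC = id := by
  funext x
  obtain ⟨x, rfl⟩ := Quot.exists_rep x
  exact congrArg (Quot.mk _) (Subtype.ext (hθ x.1))

theorem pathFiltered_monomial (θ : FilteredCurvedLieHom g h) (p : ℕ) {i : ℤ} (x : g.L i) :
    θ.pathFiltered.f i (monomial g p i x) = monomial h p i (θ.f i x) := by
  refine Prod.ext (Subtype.ext (funext fun q => ?_)) (Subtype.ext (funext fun q => ?_))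
  · change θ.f i ((Pi.single p x : ℕ → g.L i) q) = (Pi.single p (θ.f i x) : ℕ → h.L i) q
    by_cases hq : q = p
    · subst hq; simp
    · simp [Pi.single_eq_of_ne hq]
  · exact (θ.f (i - 1)).map_zero

theorem evZero_pathFiltered (θ : FilteredCurvedLieHom g h) {i : ℤ}
    (x : (CurvedLie.pathFiltered g).L i) :
    (evZero h).f i (θ.pathFiltered.f i x) = θ.f i ((evZero g).f i x) := rfl

theorem evOne_pathFiltered (θ : FilteredCurvedLieHom g h) {i : ℤ}
    (x : (CurvedLie.pathFiltered g).L i) :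
    (evOne h).f i (θ.pathFiltered.f i x) = θ.f i ((evOne g).f i x) :=
  SumsTo.unique (sumSeq_spec (θ.pathFiltered.f i x).1)
    (SumsTo.map (θ.f i) (fun hx => θ.map_F hx) (sumSeq_spec x.1))

theorem pathFiltered_primitive (θ : FilteredCurvedLieHom g h) {i j : ℤ} (e : i + 1 = j)
    (x : (CurvedLie.pathFiltered g).L j) :
    θ.pathFiltered.f i (primitive e x) = primitive e (θ.pathFiltered.f j x) := by
  refine Prod.ext (Subtype.ext (funext fun q => ?_)) (Subtype.ext (funext fun q => ?_))
  · rcases q with _ | q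
    · exact (θ.f i).map_zero
    · change θ.f i ((-1 : k) ^ i • ((q : k) + 1)⁻¹ • castL g _ _)
        = (-1 : k) ^ i • ((q : k) + 1)⁻¹ • castL h _ (θ.f (j - 1) _)
      rw [map_smul, map_smul, θ.map_castL]
      rfl
  · exact (θ.f (i - 1)).map_zero

end FilteredCurvedLieHom

/-! ### Fibre products of filtered curved Lie algebras. -/

section Pullback

variable {a b c : FilteredCurvedLieAlgebra.{u, v} k} (φ : FilteredCurvedLieHom a c)
  (ψ : FilteredCurvedLieHom b c)

/-- The homogeneous components of the fibre product. -/
abbrev PullbackL (i : ℤ) : Submodule k (a.L i × b.L i) :=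
  LinearMap.eqLocus ((φ.f i).comp (LinearMap.fst k _ _)) ((ψ.f i).comp (LinearMap.snd k _ _))

/-- The fibre product of filtered curved Lie algebras. -/
def pullback : FilteredCurvedLieAlgebra.{u, v} k where
  L i := PullbackL φ ψ i
  br {i j l} h := LinearMap.mk₂ k
    (fun x y => ⟨(a.br h x.1.1 y.1.1, b.br h x.1.2 y.1.2), by
      have hx : φ.f i x.1.1 = ψ.f i x.1.2 := x.2
      have hy : φ.f j y.1.1 = ψ.f j y.1.2 := y.2
      change φ.f l (a.br h x.1.1 y.1.1) = ψ.f l (b.br h x.1.2 y.1.2)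
      rw [φ.map_br, ψ.map_br, hx, hy]⟩)
    (fun x x' y => Subtype.ext (Prod.ext (by simp) (by simp)))
    (fun r x y => Subtype.ext (Prod.ext (by simp) (by simp)))
    (fun x y y' => Subtype.ext (Prod.ext (by simp) (by simp)))
    (fun r x y => Subtype.ext (Prod.ext (by simp) (by simp)))
  d {i j} h := ((a.d h).prodMap (b.d h)).restrict fun x (hx : φ.f i x.1 = ψ.f i x.2) => by
    change φ.f j (a.d h x.1) = ψ.f j (b.d h x.2)
    rw [φ.map_d, ψ.map_d, hx]
  Ω := ⟨(a.Ω, b.Ω), φ.map_Ω.trans ψ.map_Ω.symm⟩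
  br_antisymm h h' x y :=
    Subtype.ext (Prod.ext (a.br_antisymm h h' _ _) (b.br_antisymm h h' _ _))
  jacobi h₁ h₂ h₃ h₄ h₅ h₆ x y z := Subtype.ext
    (Prod.ext (a.jacobi h₁ h₂ h₃ h₄ h₅ h₆ _ _ _) (b.jacobi h₁ h₂ h₃ h₄ h₅ h₆ _ _ _))
  leibniz h hl hi hj h₁ h₂ x y := Subtype.ext
    (Prod.ext (a.leibniz h hl hi hj h₁ h₂ _ _) (b.leibniz h hl hi hj h₁ h₂ _ _))
  d_d h h' h₂ x := Subtype.ext (Prod.ext (a.d_d h h' h₂ _) (b.d_d h h' h₂ _))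
  d_Ω := Subtype.ext (Prod.ext a.d_Ω b.d_Ω)
  F n i := ((a.F n i).prod (b.F n i)).comap (PullbackL φ ψ i).subtype
  F_anti n i x hx := ⟨a.F_anti n i hx.1, b.F_anti n i hx.2⟩
  F_one i := eq_top_iff.2 fun x _ => ⟨mem_F_one _, mem_F_one _⟩
  br_mem h x y hx hy := ⟨a.br_mem h hx.1 hy.1, b.br_mem h hx.2 hy.2⟩
  d_mem h x hx := ⟨a.d_mem h hx.1, b.d_mem h hx.2⟩
  hausdorff x hx := Subtype.ext (Prod.ext (a.hausdorff _ fun n => (hx n).1)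
    (b.hausdorff _ fun n => (hx n).2))
  complete {i} x hx := by
    obtain ⟨y, hy⟩ := a.complete (fun n => (x n).1.1) (fun n => (hx n).1)
    obtain ⟨z, hz⟩ := b.complete (fun n => (x n).1.2) (fun n => (hx n).2)
    have hyz : φ.f i y = ψ.f i z := eq_of_sub_mem fun n => by
      have e : φ.f i (x n).1.1 = ψ.f i (x n).1.2 := (x n).2
      have := Submodule.sub_mem _ (φ.map_F (hy n)) (ψ.map_F (hz n))
      rw [map_sub, map_sub, e] at this
      simpa using this
    exact ⟨⟨(y, z), hyz⟩, fun n => ⟨hy n, hz n⟩⟩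

/-- The first projection of the fibre product. -/
def pullbackFst : FilteredCurvedLieHom (pullback φ ψ) a where
  f i := (LinearMap.fst k _ _).comp (PullbackL φ ψ i).subtype
  map_br _ _ _ := rfl
  map_d _ _ := rfl
  map_Ω := rfl
  map_F hx := hx.1

/-- The second projection of the fibre product. -/
def pullbackSnd : FilteredCurvedLieHom (pullback φ ψ) b where
  f i := (LinearMap.snd k _ _).comp (PullbackL φ ψ i).subtype
  map_br _ _ _ := rfl
  map_d _ _ := rfl
  map_Ω := rfl
  map_F hx := hx.2

variable {φ ψ}

/-- The morphism into the fibre product given by its two components. -/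
def pullbackLift {l : FilteredCurvedLieAlgebra.{u, v} k} (α : FilteredCurvedLieHom l a)
    (β : FilteredCurvedLieHom l b) (H : ∀ i x, φ.f i (α.f i x) = ψ.f i (β.f i x)) :
    FilteredCurvedLieHom l (pullback φ ψ) where
  f i := ((α.f i).prod (β.f i)).codRestrict (PullbackL φ ψ i) (H i)
  map_br e x y := Subtype.ext (Prod.ext (α.map_br e x y) (β.map_br e x y))
  map_d e x := Subtype.ext (Prod.ext (α.map_d e x) (β.map_d e x))
  map_Ω := Subtype.ext (Prod.ext α.map_Ω β.map_Ω)
  map_F hx := ⟨α.map_F hx, β.map_F hx⟩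

end Pullback

/-! ### Quasi-isomorphisms in terms of elements. -/

section QuasiIsoElements

open HomologicalComplex

variable {K L : CochainComplex (ModuleCat.{v} k) ℤ} (φ : K ⟶ L) [QuasiIso φ]

theorem exists_eq_d_of_quasiIso {i j l : ℤ} (e : i + 1 = j) (e' : j + 1 = l) (x : K.X j)
    (hx : K.d j l x = 0) (y : L.X i) (hy : φ.f j x = L.d i j y) : ∃ z, x = K.d i j z := by
  have hm : Mono (homologyMap φ j) := inferInstance
  rw [mono_homologyMap_iff_up_to_refinements φ i j l (by simp; omega) (by simp; omega)] at hm
  -- The criterion speaks of generalized elements up to an epimorphic refinement. The test object is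
  -- the module of all admissible pairs; the refinement is surjective, so it hits the given pair.
  let A : Submodule k (K.X j × L.X i) :=
    LinearMap.ker ((K.d j l).hom.comp (LinearMap.fst k _ _)) ⊓
      LinearMap.eqLocus ((φ.f j).hom.comp (LinearMap.fst k _ _))
        ((L.d i j).hom.comp (LinearMap.snd k _ _))
  obtain ⟨A', π, hπ, x₁, h⟩ := hm (A := ModuleCat.of k A)
    (ModuleCat.ofHom ((LinearMap.fst k _ _).comp A.subtype))
    (ModuleCat.hom_ext (LinearMap.ext fun a => a.2.1))
    (ModuleCat.ofHom ((LinearMap.snd k _ _).comp A.subtype))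
    (ModuleCat.hom_ext (LinearMap.ext fun a => a.2.2))
  obtain ⟨a, ha⟩ := (ModuleCat.epi_iff_surjective π).1 hπ ⟨(x, y), hx, hy⟩
  refine ⟨x₁ a, ?_⟩
  have := ConcreteCategory.congr_hom h a
  rw [ConcreteCategory.comp_apply, ConcreteCategory.comp_apply, ha] at this
  exact this

theorem exists_eq_add_d_of_quasiIso {i j l : ℤ} (e : i + 1 = j) (e' : j + 1 = l) (y : L.X j)
    (hy : L.d j l y = 0) : ∃ x z, K.d j l x = 0 ∧ y = φ.f j x + L.d i j z := by
  have hm : Epi (homologyMap φ j) := inferInstance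
  rw [epi_homologyMap_iff_up_to_refinements φ i j l (by simp; omega) (by simp; omega)] at hm
  let A : Submodule k (L.X j) := LinearMap.ker (L.d j l).hom
  obtain ⟨A', π, hπ, x₂, h₂, y₁, h⟩ := hm (A := ModuleCat.of k A) (ModuleCat.ofHom A.subtype)
    (ModuleCat.hom_ext (LinearMap.ext fun a => a.2))
  obtain ⟨a, ha⟩ := (ModuleCat.epi_iff_surjective π).1 hπ ⟨y, hy⟩
  refine ⟨x₂ a, y₁ a, ConcreteCategory.congr_hom h₂ a, ?_⟩
  have := ConcreteCategory.congr_hom h a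
  rw [ConcreteCategory.comp_apply, ha] at this
  exact this

variable {g h : FilteredCurvedLieAlgebra.{u, v} k} {θ : FilteredCurvedLieHom g h}

theorem grComplex_d_mk (n : ℕ) {i j : ℤ} (e : i + 1 = j) (x : g.F n i) :
    (grComplex g n).d i j (Submodule.Quotient.mk x : gr g n i)
      = (Submodule.Quotient.mk ⟨g.d e x, g.d_mem e x.2⟩ : gr g n j) := by
  simp only [grComplex, dif_pos e]
  rfl

theorem gr_mk_eq_iff {n : ℕ} {i : ℤ} {x y : g.F n i} :
    (Submodule.Quotient.mk x : gr g n i) = Submodule.Quotient.mk y ↔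
      (x : g.L i) - y ∈ g.F (n + 1) i := by
  rw [Submodule.Quotient.eq]
  rfl

theorem gr_mk_eq_zero_iff {n : ℕ} {i : ℤ} {x : g.F n i} :
    (Submodule.Quotient.mk x : gr g n i) = 0 ↔ (x : g.L i) ∈ g.F (n + 1) i :=
  Submodule.Quotient.mk_eq_zero _

/-- Injectivity on cohomology of the associated graded, with cosets replaced by congruences modulo
`F (n + 1)`. -/
theorem IsFilteredQuasiIso.exists_sub_d_mem (hθ : IsFilteredQuasiIso θ) {n : ℕ} {i j l : ℤ}
    (e : i + 1 = j) (e' : j + 1 = l) {x : g.L j} (hx : x ∈ g.F n j)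
    (hdx : g.d e' x ∈ g.F (n + 1) l) {y : h.L i} (hy : y ∈ h.F n i)
    (hxy : θ.f j x - h.d e y ∈ h.F (n + 1) j) :
    ∃ z ∈ g.F n i, x - g.d e z ∈ g.F (n + 1) j := by
  have := hθ n
  obtain ⟨z, hz⟩ := exists_eq_d_of_quasiIso (grComplexMap θ n) e e'
    (Submodule.Quotient.mk ⟨x, hx⟩ : gr g n j)
    ((grComplex_d_mk n e' ⟨x, hx⟩).trans (gr_mk_eq_zero_iff.2 hdx))
    (Submodule.Quotient.mk ⟨y, hy⟩ : gr h n i)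
    (Eq.trans (gr_mk_eq_iff (x := ⟨θ.f j x, θ.map_F hx⟩) (y := ⟨h.d e y, h.d_mem e hy⟩) |>.2 hxy)
      (grComplex_d_mk n e ⟨y, hy⟩).symm)
  obtain ⟨⟨z, hz'⟩, rfl⟩ := Submodule.Quotient.mk_surjective _ z
  exact ⟨z, hz', gr_mk_eq_iff.1 (hz.trans (grComplex_d_mk n e ⟨z, hz'⟩))⟩

/-- The corresponding form of surjectivity on cohomology. -/
theorem IsFilteredQuasiIso.exists_sub_sub_d_mem (hθ : IsFilteredQuasiIso θ) {n : ℕ} {i j l : ℤ}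
    (e : i + 1 = j) (e' : j + 1 = l) {y : h.L j} (hy : y ∈ h.F n j)
    (hdy : h.d e' y ∈ h.F (n + 1) l) :
    ∃ x ∈ g.F n j, g.d e' x ∈ g.F (n + 1) l ∧
      ∃ z ∈ h.F n i, y - θ.f j x - h.d e z ∈ h.F (n + 1) j := by
  have := hθ n
  obtain ⟨x, z, hx, hz⟩ := exists_eq_add_d_of_quasiIso (grComplexMap θ n) e e'
    (Submodule.Quotient.mk ⟨y, hy⟩ : gr h n j)
    ((grComplex_d_mk n e' ⟨y, hy⟩).trans (gr_mk_eq_zero_iff.2 hdy))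
  obtain ⟨⟨x, hx'⟩, rfl⟩ := Submodule.Quotient.mk_surjective _ x
  obtain ⟨⟨z, hz'⟩, rfl⟩ := Submodule.Quotient.mk_surjective _ z
  refine ⟨x, hx', gr_mk_eq_zero_iff.1 ((grComplex_d_mk n e' ⟨x, hx'⟩).symm.trans hx), z, hz', ?_⟩
  let u : h.F n j := ⟨θ.f j x, θ.map_F hx'⟩
  let w : h.F n j := ⟨h.d e z, h.d_mem e hz'⟩
  have huw : (Submodule.Quotient.mk ⟨y, hy⟩ : gr h n j) = Submodule.Quotient.mk (u + w) :=
    hz.trans (congrArg (fun w => (grComplexMap θ n).f j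
      (Submodule.Quotient.mk ⟨x, hx'⟩ : gr g n j) + w) (grComplex_d_mk n e ⟨z, hz'⟩))
  rw [sub_sub]
  exact gr_mk_eq_iff.1 huw

end QuasiIsoElements

/-! ### Curvature and obstruction theory. -/

section Lifting

/-- The curvature `Ω + dξ + ½ [ξ, ξ]` of an element of degree one. -/
def CurvedLieAlgebra.curvature (g : CurvedLieAlgebra.{u, v} k) (ξ : g.L 1) : g.L 2 :=
  g.Ω + g.d (show (1 : ℤ) + 1 = 2 by norm_num) ξ
    + (2 : k)⁻¹ • g.br (show (1 : ℤ) + 1 = 2 by norm_num) ξ ξ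

theorem CurvedLieHom.map_curvature {a b : CurvedLieAlgebra.{u, v} k} (θ : CurvedLieHom a b)
    (ξ : a.L 1) : θ.f 2 (a.curvature ξ) = b.curvature (θ.f 1 ξ) := by
  simp [CurvedLieAlgebra.curvature, θ.map_br, θ.map_d, θ.map_Ω]

theorem CurvedLieAlgebra.curvature_sub [CharZero k] (g : CurvedLieAlgebra.{u, v} k)
    (x c : g.L 1) :
    g.curvature (x - c) = g.curvature x - g.d (show (1 : ℤ) + 1 = 2 by norm_num) c
      - g.br (show (1 : ℤ) + 1 = 2 by norm_num) x c
      + (2 : k)⁻¹ • g.br (show (1 : ℤ) + 1 = 2 by norm_num) c c := by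
  have h : g.br (show (1 : ℤ) + 1 = 2 by norm_num) c x
      = g.br (show (1 : ℤ) + 1 = 2 by norm_num) x c := by
    rw [g.br_antisymm _ (show (1 : ℤ) + 1 = 2 by norm_num)]
    simp
  simp only [curvature, map_sub, LinearMap.sub_apply, h]
  module

/-- The Bianchi identity. -/
theorem CurvedLieAlgebra.d_curvature [CharZero k] (g : CurvedLieAlgebra.{u, v} k) (x : g.L 1) :
    g.d (show (2 : ℤ) + 1 = 3 by norm_num) (g.curvature x)
      = -g.br (show (1 : ℤ) + 2 = 3 by norm_num) x (g.curvature x) := by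
  have e₁ := g.d_d (show (1 : ℤ) + 1 = 2 by norm_num) (show (2 : ℤ) + 1 = 3 by norm_num)
    (show (2 : ℤ) + 1 = 3 by norm_num) x
  have anti : ∀ y : g.L 2, g.br (show (2 : ℤ) + 1 = 3 by norm_num) y x
      = -g.br (show (1 : ℤ) + 2 = 3 by norm_num) x y := by
    intro y
    rw [g.br_antisymm _ (show (1 : ℤ) + 2 = 3 by norm_num)]
    simp
  have e₂ := g.leibniz (show (1 : ℤ) + 1 = 2 by norm_num) (show (2 : ℤ) + 1 = 3 by norm_num)
    (show (1 : ℤ) + 1 = 2 by norm_num) (show (1 : ℤ) + 1 = 2 by norm_num)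
    (show (2 : ℤ) + 1 = 3 by norm_num) (show (1 : ℤ) + 2 = 3 by norm_num) x x
  have e₃ := g.jacobi (show (1 : ℤ) + 1 = 2 by norm_num) (show (1 : ℤ) + 2 = 3 by norm_num)
    (show (1 : ℤ) + 1 = 2 by norm_num) (show (2 : ℤ) + 1 = 3 by norm_num)
    (show (1 : ℤ) + 1 = 2 by norm_num) (show (1 : ℤ) + 2 = 3 by norm_num) x x x
  -- With antisymmetry, Jacobi for `x, x, x` reads `J = -J - J` where `J = [x, [x, x]]`, so `3 J =
  -- 0`.
  have e₄ : g.br (show (1 : ℤ) + 2 = 3 by norm_num) x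
      (g.br (show (1 : ℤ) + 1 = 2 by norm_num) x x) = 0 := by
    rw [anti] at e₃
    have h3 : (3 : k) • g.br (show (1 : ℤ) + 2 = 3 by norm_num) x
        (g.br (show (1 : ℤ) + 1 = 2 by norm_num) x x) = 0 := by
      have : (1 : k) • g.br (show (1 : ℤ) + 2 = 3 by norm_num) x
        (g.br (show (1 : ℤ) + 1 = 2 by norm_num) x x) = _ := (one_smul _ _).trans e₃
      rw [← sub_eq_zero] at this
      rw [← this]
      simp only [mul_one, zpow_one]
      module
    exact (smul_eq_zero.1 h3).resolve_left (by norm_num)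
  rw [anti] at e₁ e₂
  simp only [curvature, map_add, map_smul, e₁, e₂, e₄, g.d_Ω, zpow_one]
  match_scalars <;> norm_num

theorem curvature_mem_of_sub_mem [CharZero k] {g : FilteredCurvedLieAlgebra.{u, v} k} {n : ℕ}
    {x y : g.L 1} (hxy : x - y ∈ g.F n 1) (hx : g.curvature x ∈ g.F n 2) :
    g.curvature y ∈ g.F n 2 := by
  have := g.curvature_sub x (x - y)
  rw [sub_sub_cancel] at this
  rw [this]
  exact Submodule.add_mem _ (Submodule.sub_mem _ (Submodule.sub_mem _ hx (g.d_mem _ hxy))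
    (br_mem_right _ _ hxy)) (Submodule.smul_mem _ _ (br_mem_right _ _ hxy))

/-- Obstruction theory: a Maurer–Cartan element modulo an ideal `N` with acyclic associated graded
can be corrected by an element of `N` to a Maurer–Cartan element. -/
theorem exists_isMC_of_acyclic [CharZero k] {g : FilteredCurvedLieAlgebra.{u, v} k}
    (N₁ : Submodule k (g.L 1)) (N₂ : Submodule k (g.L 2))
    (hclosed : ∀ x, (∀ n, ∃ y ∈ N₁, x - y ∈ g.F n 1) → x ∈ N₁)
    (hd : ∀ x ∈ N₁, g.d (show (1 : ℤ) + 1 = 2 by norm_num) x ∈ N₂)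
    (hbr : ∀ x, ∀ y ∈ N₁, g.br (show (1 : ℤ) + 1 = 2 by norm_num) x y ∈ N₂)
    (hacyclic : ∀ n, ∀ u ∈ g.F n 2, u ∈ N₂ →
      g.d (show (2 : ℤ) + 1 = 3 by norm_num) u ∈ g.F (n + 1) 3 →
      ∃ c ∈ g.F n 1, c ∈ N₁ ∧ u - g.d (show (1 : ℤ) + 1 = 2 by norm_num) c ∈ g.F (n + 1) 2)
    (x₀ : g.L 1) (hx₀ : g.curvature x₀ ∈ N₂) : ∃ x, g.IsMC x ∧ x - x₀ ∈ N₁ := by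
  let P (n : ℕ) : Type v :=
    {x : g.L 1 // g.curvature x ∈ g.F n 2 ∧ g.curvature x ∈ N₂ ∧ x - x₀ ∈ N₁}
  have step : ∀ n (x : P n), ∃ y : P (n + 1), y.1 - x.1 ∈ g.F n 1 := by
    rintro n ⟨x, hx, hx2, hxN⟩
    -- The curvature is a cocycle modulo `F (n + 1)` by Bianchi. Subtracting `c` from `x` changes it
    -- by `-d c` up to brackets with `c`, which lie in `F (n + 1)`.
    obtain ⟨c, hc, hcN, hc'⟩ := hacyclic n _ hx hx2 (by
      rw [g.d_curvature]
      exact Submodule.neg_mem _ (br_mem_succ _ _ hx))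
    refine ⟨⟨x - c, ?_, ?_, ?_⟩, ?_⟩
    · rw [g.curvature_sub]
      exact Submodule.add_mem _ (Submodule.sub_mem _ hc' (br_mem_succ _ _ hc))
        (Submodule.smul_mem _ _ (br_mem_succ _ _ hc))
    · rw [g.curvature_sub]
      exact Submodule.add_mem _ (Submodule.sub_mem _ (Submodule.sub_mem _ hx2 (hd _ hcN))
        (hbr _ _ hcN)) (Submodule.smul_mem _ _ (hbr _ _ hcN))
    · rw [sub_right_comm]
      exact Submodule.sub_mem _ hxN hcN
    · rw [sub_sub_cancel_left]
      exact Submodule.neg_mem _ hc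
  choose next hnext using step
  -- The iteration can start at `x₀` because `F 0` is everything.
  let s : ∀ n, P n := fun n => Nat.rec
    (⟨x₀, mem_F_zero _, hx₀, by rw [sub_self]; exact Submodule.zero_mem _⟩ : P 0) next n
  obtain ⟨y, hy⟩ := g.complete (fun n => (s n).1) (fun n => hnext n (s n))
  refine ⟨y, g.hausdorff _ fun n => ?_, hclosed _ fun n => ⟨(s n).1 - x₀, (s n).2.2.2, ?_⟩⟩
  · refine curvature_mem_of_sub_mem ?_ (s n).2.1
    rw [← neg_sub]
    exact Submodule.neg_mem _ (hy n)
  · simpa using hy n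

end Lifting

/-! ### Acyclic fibrations induce bijections on moduli sets. -/

section AcyclicFibration

variable {a b : FilteredCurvedLieAlgebra.{u, v} k}

/-- Morphisms which are surjective on every step of the filtration and whose kernel has an acyclic
associated graded complex. -/
structure IsAcyclicFibration (φ : FilteredCurvedLieHom a b) : Prop where
  exists_lift : ∀ {n : ℕ} {i : ℤ} {y : b.L i}, y ∈ b.F n i → ∃ x ∈ a.F n i, φ.f i x = y
  exact : ∀ {n : ℕ} {i j l : ℤ} (e : i + 1 = j) (e' : j + 1 = l) {x : a.L j}, x ∈ a.F n j →
    φ.f j x = 0 → a.d e' x ∈ a.F (n + 1) l →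
    ∃ c ∈ a.F n i, φ.f i c = 0 ∧ x - a.d e c ∈ a.F (n + 1) j

theorem CurvedLieHom.map_d_eq_zero {a b : CurvedLieAlgebra.{u, v} k} (φ : CurvedLieHom a b)
    {i j : ℤ} (e : i + 1 = j) {x : a.L i} (hx : φ.f i x = 0) : φ.f j (a.d e x) = 0 := by
  rw [φ.map_d, hx, map_zero]

theorem CurvedLieHom.map_br_eq_zero {a b : CurvedLieAlgebra.{u, v} k} (φ : CurvedLieHom a b)
    {i j l : ℤ} (e : i + j = l) (x : a.L i) {y : a.L j} (hy : φ.f j y = 0) :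
    φ.f l (a.br e x y) = 0 := by
  rw [φ.map_br, hy, map_zero]

/-- Kernels are closed because the target is Hausdorff. This keeps the limit of the corrections in
the kernel. -/
theorem FilteredCurvedLieHom.map_eq_zero_of_limit (φ : FilteredCurvedLieHom a b) {i : ℤ}
    {x : a.L i} (hx : ∀ n, ∃ y, φ.f i y = 0 ∧ x - y ∈ a.F n i) : φ.f i x = 0 := by
  refine b.hausdorff _ fun n => ?_
  obtain ⟨y, hy, hxy⟩ := hx n
  simpa [hy] using φ.map_F hxy

namespace IsAcyclicFibration

variable {φ : FilteredCurvedLieHom a b} (hφ : IsAcyclicFibration φ)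
include hφ

theorem exists_mapMC_eq [CharZero k] (η : b.MC) : ∃ ξ : a.MC, φ.mapMC ξ = η := by
  obtain ⟨x₀, -, hx₀⟩ := hφ.exists_lift (mem_F_zero η.1)
  obtain ⟨x, hx, hxx₀⟩ := exists_isMC_of_acyclic (LinearMap.ker (φ.f 1)) (LinearMap.ker (φ.f 2))
    (fun x hx => φ.map_eq_zero_of_limit hx)
    (fun x hx => φ.map_d_eq_zero _ hx) (fun x y hy => φ.map_br_eq_zero _ x hy)
    (fun n u hu hu' hdu => hφ.exact _ _ hu hu' hdu) x₀
    ((φ.map_curvature x₀).trans (by rw [hx₀]; exact η.2))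
  refine ⟨⟨x, hx⟩, Subtype.ext ?_⟩
  have : φ.f 1 (x - x₀) = 0 := hxx₀
  rw [map_sub, sub_eq_zero] at this
  exact this.trans hx₀

/-- An arbitrary termwise lift need not tend to zero, so each term is lifted within a filtration
step that deepens along the sequence. -/
theorem exists_nullSeq_lift {i : ℤ} (s : nullSeq b i) :
    ∃ t : nullSeq a i, ∀ p, φ.f i ((t : ℕ → a.L i) p) = (s : ℕ → b.L i) p := by
  classical
  -- The search is capped at `p` because a zero term lies in every `F n`; the cap still tends to
  -- infinity.
  let m : ℕ → ℕ := fun p => Nat.findGreatest (fun n => (s : ℕ → b.L i) p ∈ b.F n i) p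
  have hm : ∀ p, (s : ℕ → b.L i) p ∈ b.F (m p) i := fun p =>
    Nat.findGreatest_spec (P := fun n => (s : ℕ → b.L i) p ∈ b.F n i) (Nat.zero_le p)
      (mem_F_zero _)
  choose t ht hts using fun p => hφ.exists_lift (hm p)
  refine ⟨⟨t, fun n => ?_⟩, hts⟩
  obtain ⟨N, hN⟩ := s.2 n
  exact ⟨N + n, fun p hp =>
    F_le (Nat.le_findGreatest (by omega) (hN p (by omega))) i (ht p)⟩

theorem exists_path_lift {i : ℤ} (y : (pathFiltered b).L i) :
    ∃ x, φ.pathFiltered.f i x = y := by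
  obtain ⟨s, hs⟩ := hφ.exists_nullSeq_lift y.1
  obtain ⟨t, ht⟩ := hφ.exists_nullSeq_lift y.2
  exact ⟨(s, t), Prod.ext (Subtype.ext (funext hs)) (Subtype.ext (funext ht))⟩

theorem exists_path_lift_of_endpoints {i : ℤ} (y : (pathFiltered b).L i) {x₀ x₁ : a.L i}
    (h₀ : (evZero b).f i y = φ.f i x₀) (h₁ : (evOne b).f i y = φ.f i x₁) :
    ∃ x, φ.pathFiltered.f i x = y ∧ (evZero a).f i x = x₀ ∧ (evOne a).f i x = x₁ := by
  obtain ⟨x, hx⟩ := hφ.exists_path_lift y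
  have e₀ : φ.f i ((evZero a).f i x) = φ.f i x₀ := by
    rw [← φ.evZero_pathFiltered, hx, h₀]
  have e₁ : φ.f i ((evOne a).f i x) = φ.f i x₁ := by
    rw [← φ.evOne_pathFiltered, hx, h₁]
  -- The constant term repairs the value at `0`, the linear term the error then left at `1`. Both
  -- errors lie in the kernel of `φ`, so the image path is unchanged.
  refine ⟨x + (constPath a).f i (x₀ - (evZero a).f i x)
    + monomial a 1 i ((x₁ - (evOne a).f i x) - (x₀ - (evZero a).f i x)), ?_, ?_, ?_⟩
  · rw [map_add, map_add, φ.pathFiltered_monomial]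
    change _ + φ.pathFiltered.f i (monomial a 0 i _) + _ = _
    rw [φ.pathFiltered_monomial]
    simp [hx, e₀, e₁]
  · simp [evZero_const, evZero_monomial]
  · simp [evOne_const, evOne_monomial]

/-- The primitive `q` of `x` vanishes at `0` but perhaps not at `1`. Its value there is a cocycle
modulo `F (n + 1)` in the kernel of `φ`, so it is `d m` up to `F (n + 1)`; subtracting `d (m z)` and
the small remainder times `z` makes the end point vanish exactly. -/
theorem path_exact [CharZero k] {n : ℕ} {i₀ i j l : ℤ} (e₀ : i₀ + 1 = i) (e : i + 1 = j)
    (e' : j + 1 = l) {x : (pathFiltered a).L j} (hx : x ∈ (pathFiltered a).F n j)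
    (hφx : φ.pathFiltered.f j x = 0) (hx₀ : (evZero a).f j x = 0) (hx₁ : (evOne a).f j x = 0)
    (hdx : (pathFiltered a).d e' x ∈ (pathFiltered a).F (n + 1) l) :
    ∃ c ∈ (pathFiltered a).F n i, (φ.pathFiltered.f i c = 0 ∧ (evZero a).f i c = 0 ∧
      (evOne a).f i c = 0) ∧ x - (pathFiltered a).d e c ∈ (pathFiltered a).F (n + 1) j := by
  obtain ⟨q, hq⟩ : ∃ q, q = primitive e x := ⟨_, rfl⟩
  have hqF : q ∈ (pathFiltered a).F n i := hq ▸ primitive_mem e hx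
  have hq₀ : (evZero a).f i q = 0 := hq ▸ evZero_primitive e x
  have hφq : φ.pathFiltered.f i q = 0 := by
    rw [hq, φ.pathFiltered_primitive, hφx]
    refine Prod.ext (Subtype.ext (funext fun p => ?_)) rfl
    rcases p with _ | p
    · rfl
    · change (-1 : k) ^ i • ((p : k) + 1)⁻¹ • castL b _ 0 = 0
      simp
  have hxq : x - (pathFiltered a).d e q ∈ (pathFiltered a).F (n + 1) j := by
    have := sub_d_primitive_mem e e' hx hdx
    rwa [hx₀, map_zero, sub_zero, ← hq] at this
  have hy : a.d e ((evOne a).f i q) ∈ a.F (n + 1) j := by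
    have := (evOne a).map_F hxq
    rw [map_sub, hx₁, zero_sub, (evOne a).map_d] at this
    simpa using Submodule.neg_mem _ this
  obtain ⟨m, hm, hφm, hm'⟩ := hφ.exact e₀ e ((evOne a).map_F hqF)
    (by rw [← φ.evOne_pathFiltered, hφq, map_zero]) hy
  have hφy : φ.f i ((evOne a).f i q) = 0 := by rw [← φ.evOne_pathFiltered, hφq, map_zero]
  refine ⟨q - (pathFiltered a).d e₀ (monomial a 1 i₀ m)
    - monomial a 1 i ((evOne a).f i q - a.d e₀ m), ?_, ⟨?_, ?_, ?_⟩, ?_⟩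
  · exact Submodule.sub_mem _ (Submodule.sub_mem _ hqF ((pathFiltered a).d_mem _
      (monomial_mem 1 hm))) (monomial_mem 1 ((a.F_anti n i) hm'))
  · rw [map_sub, map_sub, hφq, φ.pathFiltered.map_d, φ.pathFiltered_monomial,
      φ.pathFiltered_monomial, hφm, map_sub, φ.map_d, hφm, hφy]
    simp
  · rw [map_sub, map_sub, hq₀, (evZero a).map_d, evZero_monomial, evZero_monomial]
    simp
  · rw [map_sub, map_sub, (evOne a).map_d, evOne_monomial, evOne_monomial, sub_self]
  · rw [map_sub, map_sub, ← sub_add, ← sub_add]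
    exact Submodule.add_mem _ (Submodule.add_mem _ hxq (d_d_mem _ _ (monomial_mem 1 hm)))
      ((pathFiltered a).d_mem _ (monomial_mem 1 hm'))

theorem homotopic_of_homotopic_map [CharZero k] {ξ ξ' : a.MC}
    (H : Homotopic b (φ.mapMC ξ) (φ.mapMC ξ')) : Homotopic a ξ ξ' := by
  obtain ⟨p, hp₀, hp₁⟩ := H
  obtain ⟨x, hx, hx₀, hx₁⟩ := hφ.exists_path_lift_of_endpoints (x₀ := ξ.1) (x₁ := ξ'.1) p.1
    (evalsTo_zero_iff.1 hp₀) (evalsTo_one_iff.1 hp₁)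
  let N (i : ℤ) : Submodule k ((pathFiltered a).L i) := LinearMap.ker (φ.pathFiltered.f i) ⊓
    (LinearMap.ker ((evZero a).f i) ⊓ LinearMap.ker ((evOne a).f i))
  obtain ⟨q, hq, hqx⟩ := exists_isMC_of_acyclic (g := pathFiltered a) (N 1) (N 2)
    (fun x hx => ⟨φ.pathFiltered.map_eq_zero_of_limit fun n =>
        let ⟨y, hy, h⟩ := hx n; ⟨y, hy.1, h⟩,
      (evZero a).map_eq_zero_of_limit fun n => let ⟨y, hy, h⟩ := hx n; ⟨y, hy.2.1, h⟩,
      (evOne a).map_eq_zero_of_limit fun n => let ⟨y, hy, h⟩ := hx n; ⟨y, hy.2.2, h⟩⟩)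
    (fun x hx => ⟨φ.pathFiltered.map_d_eq_zero _ hx.1, (evZero a).map_d_eq_zero _ hx.2.1,
      (evOne a).map_d_eq_zero _ hx.2.2⟩)
    (fun x y hy => ⟨φ.pathFiltered.map_br_eq_zero _ x hy.1, (evZero a).map_br_eq_zero _ x hy.2.1,
      (evOne a).map_br_eq_zero _ x hy.2.2⟩)
    (fun n u hu hu' hdu => hφ.path_exact (show (0 : ℤ) + 1 = 1 by norm_num) _ _ hu
      hu'.1 hu'.2.1 hu'.2.2 hdu) x
    ⟨(φ.pathFiltered.map_curvature x).trans (by rw [hx]; exact p.2),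
      ((evZero a).map_curvature x).trans (by rw [hx₀]; exact ξ.2),
      ((evOne a).map_curvature x).trans (by rw [hx₁]; exact ξ'.2)⟩
  have e₀ : (evZero a).f 1 (q - x) = 0 := hqx.2.1
  have e₁ : (evOne a).f 1 (q - x) = 0 := hqx.2.2
  rw [map_sub, sub_eq_zero] at e₀ e₁
  exact ⟨⟨q, hq⟩, evalsTo_zero_iff.2 (e₀.trans hx₀), evalsTo_one_iff.2 (e₁.trans hx₁)⟩

/-- Homotopies are lifted one link of the chain at a time, for all lifts of the ends of the link. -/
theorem mk_eq_of_eqvGen [CharZero k] {η η' : b.MC} (H : Relation.EqvGen (Homotopic b) η η') :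
    ∀ ξ ξ' : a.MC, φ.mapMC ξ = η → φ.mapMC ξ' = η' →
      Quot.mk (Homotopic a) ξ = Quot.mk (Homotopic a) ξ' := by
  induction H with
  | rel η η' h =>
    rintro ξ ξ' rfl rfl
    exact Quot.sound (hφ.homotopic_of_homotopic_map h)
  | refl η =>
    -- Two lifts of the same element may differ; lifting the constant path joins them.
    rintro ξ ξ' rfl h
    refine Quot.sound (hφ.homotopic_of_homotopic_map
      ⟨(constPath b).mapMC (φ.mapMC ξ), evalsTo_zero_iff.2 (evZero_const _), ?_⟩)
    rw [h]
    exact evalsTo_one_iff.2 (evOne_const _)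
  | symm η η' _ ih => exact fun ξ ξ' h h' => (ih ξ' ξ h' h).symm
  | trans η η' η'' _ _ ih ih' =>
    intro ξ ξ'' h h''
    -- The intermediate element must itself be lifted before the two halves can be joined.
    obtain ⟨ξ', h'⟩ := hφ.exists_mapMC_eq η'
    exact (ih ξ ξ' h h').trans (ih' ξ' ξ'' h' h'')

theorem bijective_mapModuliMC [CharZero k] : Function.Bijective φ.mapModuliMC := by
  constructor
  · intro x y hxy
    obtain ⟨ξ, rfl⟩ := Quot.exists_rep x
    obtain ⟨ξ', rfl⟩ := Quot.exists_rep y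
    exact hφ.mk_eq_of_eqvGen (Quot.eqvGen_exact hxy) ξ ξ' rfl rfl
  · intro y
    obtain ⟨η, rfl⟩ := Quot.exists_rep y
    obtain ⟨ξ, rfl⟩ := hφ.exists_mapMC_eq η
    exact ⟨Quot.mk _ ξ, rfl⟩

end IsAcyclicFibration

end AcyclicFibration

/-! ### Factorization through the mapping path object, and the theorem. -/

section PathFibration

variable {g h : FilteredCurvedLieAlgebra.{u, v} k} (θ : FilteredCurvedLieHom g h)

/-- The mapping path object of `θ`: pairs of an element of `g` and a path in `h` that starts at its
image. -/
abbrev pathObject : FilteredCurvedLieAlgebra.{u, v} k := pullback θ (evZero h)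

/-- The projection of the mapping path object to `g`. -/
abbrev pathObjectSource : FilteredCurvedLieHom (pathObject θ) g := pullbackFst θ (evZero h)

/-- The end point of the path. -/
noncomputable abbrev pathObjectTarget : FilteredCurvedLieHom (pathObject θ) h :=
  (evOne h).comp (pullbackSnd θ (evZero h))

/-- The inclusion of `g` into the mapping path object by the constant paths. -/
def pathObjectSection : FilteredCurvedLieHom g (pathObject θ) :=
  pullbackLift ⟨⟨fun _ => LinearMap.id, fun _ _ _ => rfl, fun _ _ => rfl, rfl⟩, fun hx => hx⟩
    ((constPath h).comp θ) fun i x => (evZero_const (θ.f i x)).symm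

theorem pathObjectSource_comp_section_mapModuliMC (x : ModuliMC g) :
    (pathObjectSource θ).mapModuliMC ((pathObjectSection θ).mapModuliMC x) = x := by
  rw [← Function.comp_apply (f := (pathObjectSource θ).mapModuliMC),
    ← FilteredCurvedLieHom.mapModuliMC_comp, FilteredCurvedLieHom.mapModuliMC_eq_id _ fun _ => rfl]
  rfl

theorem pathObjectTarget_comp_section_mapModuliMC :
    (pathObjectTarget θ).mapModuliMC ∘ (pathObjectSection θ).mapModuliMC = θ.mapModuliMC := by
  funext x
  obtain ⟨ξ, rfl⟩ := Quot.exists_rep x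
  exact congrArg (Quot.mk _) (Subtype.ext (evOne_const (θ.f 1 ξ.1)))

/-- The kernel consists of the paths in `h` starting at `0`, which integration contracts on the
associated graded. Nothing is assumed of `θ`. -/
theorem isAcyclicFibration_pathObjectSource [CharZero k] :
    IsAcyclicFibration (pathObjectSource θ) where
  exists_lift {n i y} hy :=
    ⟨(pathObjectSection θ).f i y, (pathObjectSection θ).map_F hy, rfl⟩
  exact {n i j l} e e' x hx hx0 hdx := by
    obtain ⟨⟨x, p⟩, hxp⟩ := x
    obtain rfl : x = 0 := hx0
    have hp : (evZero h).f j p = 0 := hxp.symm.trans (map_zero (θ.f j))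
    have key := sub_d_primitive_mem e e' hx.2 hdx.2
    change p - (pathFiltered h).d e (primitive e p) - (constPath h).f j ((evZero h).f j p) ∈ _
      at key
    rw [hp, map_zero, sub_zero] at key
    refine ⟨⟨(0, primitive e p), map_zero (θ.f i)⟩,
      ⟨Submodule.zero_mem _, primitive_mem e hx.2⟩, rfl, ?_, key⟩
    change 0 - g.d e 0 ∈ g.F (n + 1) j
    rw [map_zero, sub_zero]
    exact Submodule.zero_mem _

variable {θ}

/-- The linear path `y z` with source `0` lifts `y`. Exactness uses injectivity of `θ` on graded
cohomology in degree `j` and surjectivity in degree `i`, as in the long exact sequence of a cone. -/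
theorem IsFilteredQuasiIso.isAcyclicFibration_pathObjectTarget [CharZero k]
    (hθ : IsFilteredQuasiIso θ) : IsAcyclicFibration (pathObjectTarget θ) where
  exists_lift {n i y} hy :=
    ⟨⟨(0, monomial h 1 i y), (map_zero (θ.f i)).trans (evZero_monomial y).symm⟩,
      ⟨Submodule.zero_mem _, monomial_mem 1 hy⟩, evOne_monomial y⟩
  exact {n i j l} e e' x hx hx1 hdx := by
    obtain ⟨⟨x, p⟩, hxp⟩ := x
    obtain ⟨hxF, hpF⟩ : x ∈ g.F n j ∧ p ∈ (pathFiltered h).F n j := hx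
    obtain ⟨hdxF, hdpF⟩ : g.d e' x ∈ g.F (n + 1) l ∧
      (pathFiltered h).d e' p ∈ (pathFiltered h).F (n + 1) l := hdx
    replace hxp : θ.f j x = (evZero h).f j p := hxp
    replace hx1 : (evOne h).f j p = 0 := hx1
    have key := sub_d_primitive_mem e e' hpF hdpF
    obtain ⟨q, hq⟩ : ∃ q, q = primitive e p := ⟨_, rfl⟩
    have hqF : q ∈ (pathFiltered h).F n i := hq ▸ primitive_mem e hpF
    have hq0 : (evZero h).f i q = 0 := hq ▸ evZero_primitive e p
    rw [← hq, ← hxp] at key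
    -- Evaluating `p ≡ d q + θ x` at `z = 1`, where `p` vanishes, shows that `θ x` is a coboundary
    -- modulo `F (n + 1)`.
    have h1 : θ.f j x + h.d e ((evOne h).f i q) ∈ h.F (n + 1) j := by
      have := Submodule.neg_mem _ ((evOne h).map_F key)
      rw [map_sub, map_sub, hx1, evOne_const, (evOne h).map_d] at this
      convert this using 1
      abel
    obtain ⟨v, hvF, hv⟩ := hθ.exists_sub_d_mem e e' hxF hdxF
      (y := -(evOne h).f i q) (Submodule.neg_mem _ ((evOne h).map_F hqF))
      (by rwa [map_neg, sub_neg_eq_add])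
    -- Now `x ≡ d v`, but `θ v + q|_{z = 1}` is only a cocycle. Replacing `v` by `v - w` turns it
    -- into the coboundary `d m` up to the remainder `r`.
    obtain ⟨w, hwF, hdw, m, hmF, hm⟩ := hθ.exists_sub_sub_d_mem
      (show i - 1 + 1 = i by omega) e (y := θ.f i v + (evOne h).f i q)
      (Submodule.add_mem _ (θ.map_F hvF) ((evOne h).map_F hqF)) (by
        have := Submodule.sub_mem _ h1 (θ.map_F hv)
        rw [map_sub, θ.map_d] at this
        rw [map_add]
        convert this using 1
        abel)
    obtain ⟨r, hr⟩ : ∃ r, r = θ.f i v + (evOne h).f i q - θ.f i w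
      - h.d (show i - 1 + 1 = i by omega) m := ⟨_, rfl⟩
    rw [← hr] at hm
    -- The constant makes `c` start at `θ (v - w)`; the terms `d (m z)` and `r z` vanish at `0` and
    -- cancel the value at `1`, while changing `d c` only within `F (n + 1)`.
    obtain ⟨c, hc⟩ : ∃ c, c = q + (constPath h).f i (θ.f i (v - w))
      - (pathFiltered h).d (show i - 1 + 1 = i by omega) (monomial h 1 (i - 1) m)
      - monomial h 1 i r := ⟨_, rfl⟩
    have hc0 : θ.f i (v - w) = (evZero h).f i c := by
      rw [hc, map_sub ((evZero h).f i), map_sub ((evZero h).f i), map_add, hq0,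
        evZero_const, (evZero h).map_d, evZero_monomial, evZero_monomial]
      simp
    have hc1 : (evOne h).f i c = 0 := by
      rw [hc, map_sub ((evOne h).f i), map_sub ((evOne h).f i), map_add,
        evOne_const, (evOne h).map_d, evOne_monomial, evOne_monomial, hr, map_sub]
      abel
    have hcF : c ∈ (pathFiltered h).F n i := by
      rw [hc]
      exact Submodule.sub_mem _ (Submodule.sub_mem _ (Submodule.add_mem _ hqF
        ((constPath h).map_F (θ.map_F (Submodule.sub_mem _ hvF hwF))))
        ((pathFiltered h).d_mem _ (monomial_mem 1 hmF))) (monomial_mem 1 (h.F_anti n i hm))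
    have hvw : x - g.d e (v - w) ∈ g.F (n + 1) j := by
      rw [map_sub, ← sub_add]
      exact Submodule.add_mem _ hv hdw
    refine ⟨⟨(v - w, c), hc0⟩, ⟨Submodule.sub_mem _ hvF hwF, hcF⟩, hc1, hvw, ?_⟩
    change p - (pathFiltered h).d e c ∈ (pathFiltered h).F (n + 1) j
    have h3 := (constPath h).map_F (θ.map_F hvw)
    have h4 := d_d_mem (g := pathFiltered h) (show i - 1 + 1 = i by omega) e
      (monomial_mem 1 hmF)
    have h5 := (pathFiltered h).d_mem e (monomial_mem 1 hm)
    have := Submodule.add_mem _ (Submodule.add_mem _ (Submodule.add_mem _ key h3) h4) h5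
    convert this using 1
    rw [hc, map_sub (θ.f j), map_sub ((constPath h).f j), θ.map_d, (constPath h).map_d,
      map_sub ((pathFiltered h).d e), map_sub ((pathFiltered h).d e),
      map_add ((pathFiltered h).d e)]
    abel

theorem IsFilteredQuasiIso.bijective_mapModuliMC [CharZero k] (hθ : IsFilteredQuasiIso θ) :
    Function.Bijective θ.mapModuliMC := by
  -- A right inverse of a bijection is a bijection.
  have hs : Function.Bijective (pathObjectSection θ).mapModuliMC := by
    refine ⟨Function.LeftInverse.injective (pathObjectSource_comp_section_mapModuliMC θ),
      fun y => ⟨(pathObjectSource θ).mapModuliMC y, ?_⟩⟩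
    apply (isAcyclicFibration_pathObjectSource θ).bijective_mapModuliMC.1
    rw [pathObjectSource_comp_section_mapModuliMC]
  rw [← pathObjectTarget_comp_section_mapModuliMC]
  exact hθ.isAcyclicFibration_pathObjectTarget.bijective_mapModuliMC.comp hs

end PathFibration

end CurvedLie

theorem mainTheorem8 {k : Type u} [Field k] [CharZero k]
    (g h : CurvedLie.FilteredCurvedLieAlgebra.{u, v} k)
    (θ : CurvedLie.FilteredCurvedLieHom g h) (hθ : CurvedLie.IsFilteredQuasiIso θ) :
    Function.Bijective θ.mapModuliMC := by
  exact hθ.bijective_mapModuliMC
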